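/- Let $A,B$ be finite-dimensional quantum systems of dimension at least $1$. A linear map on matrices is a (quantum) channel if it is completely positive and trace preserving, and unital if it fixes the identity. A channel $AB\to A'B'$ is one-way LOCC if it equals a finite sum $\sum_a\Phi_a\otimes\Psi_a$, where either all $\Phi_a:A\to A'$ are completely positive with $\sum_a\Phi_a$ a channel and all $\Psi_a:B\to B'$ are channels, or the same with the two parties exchanged; it is LOCC if it is a finite composition of one-way LOCC channels (in either direction, through arbitrary finite-dimensional intermediate bipartite systems). Let $\overline{\mathrm{LOCC}}(A\!:\!B)$ be the closure of the set of LOCC channels $AB\to AB$. A bipartite measurement with $n$ outcomes per party is a POVM $\mathcal M=\{M_{xy}\}_{x,y=0}^{n-1}$ ($M_{xy}\ge 0$, $\sum_{x,y} M_{xy}=I$), identified with the channel $\rho\mapsto\sum_{x,y}\operatorname{tr}(M_{xy}\rho)\,|x\rangle\langle x|_{A'}\otimes|y\rangle\langle y|_{B'}$; it is an LOCC measurement if this channel is LOCC, and $\overline{\mathrm{LOCC}}_{\mathcal M}$ denotes the closure of the set of LOCC measurements with a given number of outcomes. For $X,Y\ge0$ let $D(X\Vert Y)=\operatorname{tr}X\log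 X-\operatorname{tr}X\log Y$ if $\ker Y\subseteq\ker X$ and $D(X\Vert Y)=+\infty$ otherwise. For measurements $\mathcal M=\{M_x\}$, $\mathcal N=\{N_x\}$ on a system of dimension $D_0$ let $D_m(\mathcal M\Vert\mathcal N)=\frac1{D_0}\sum_xD(M_x\Vert N_x)$. Fix a set $\mathbf N\subseteq\mathbb N$ of admissible numbers of outcomes per party, containing some $n\ge2$ (for example $\mathbf N=\{n\}$ with $n\ge 2$, or $\mathbf N=\mathbb N$). The measurement-entangling power of a channel $\mathcal E$ on $AB$ is $$E(\mathcal E)=\inf_{\mathcal F\in\overline{\mathrm{LOCC}}(A:B)}\ \sup_{\widetilde A,\widetilde B,\mathcal M}\ D_m\big(\mathcal M\circ(\mathcal E\otimes\mathrm{id}_{\widetilde A\widetilde B})\,\big\Vert\,\mathcal M\circ(\mathcal F\otimes\mathrm{id}_{\widetilde A\widetilde B})\big)\in[-\infty,+\infty],$$ where the supremum is over all finite-dimensional ancillas $\widetilde A,\widetilde B$ of dimension at least $1$ and all $\mathcal M\in\overline{\mathrm{LOCC}}_{\mathcal M}(A\widetilde A\!:\!B\widetilde B)$ whose number of outcomes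 per party lies in $\mathbf N$. Then $E$ is a resource monotone: 1. (Non-negativity and faithfulness) For every channel $\mathcal E$ on $AB$, $E(\mathcal E)\ge0$, and $E(\mathcal E)=0$ if and only if $\mathcal E\in\overline{\mathrm{LOCC}}(A\!:\!B)$. 2. (Monotonicity) For every channel $\mathcal E$ on $AB$, every $\mathcal K\in\overline{\mathrm{LOCC}}(A\!:\!B)$ and every unital $\mathcal L\in\overline{\mathrm{LOCC}}(A\!:\!B)$, $E(\mathcal K\circ\mathcal E\circ\mathcal L)\le E(\mathcal E)$. 3. (Convexity) For all channels $\mathcal E,\mathcal G$ on $AB$ and all $0\le p\le1$, $E(p\mathcal E+(1-p)\mathcal G)\le pE(\mathcal E)+(1-p)E(\mathcal G)$. -/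

import Mathlib

open scoped ComplexOrder

namespace QuantumResource

/-- Square complex matrices; a finite type `S` stands for a quantum system with Hilbert space
`ℂ^S`, whose standard basis is the computational basis. -/
abbrev Op (S : Type) : Type := Matrix S S ℂ

section Channels

variable {A A' B B' : Type}

/-- The tensor product `Φ ⊗ Ψ` of linear maps on matrices. -/
def tensorMap (Φ : Op A →ₗ[ℂ] Op A') (Ψ : Op B →ₗ[ℂ] Op B') :
    Op (A × B) →ₗ[ℂ] Op (A' × B') where
  toFun X := Matrix.of fun p q =>
    Φ (Matrix.of fun a c => Ψ (Matrix.of fun b d => X (a, b) (c, d)) p.2 q.2) p.1 q.1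
  map_add' X Y := by
    ext p q
    have h : (Matrix.of fun a c => Ψ (Matrix.of fun b d => (X + Y) (a, b) (c, d)) p.2 q.2 : Op A) =
        (Matrix.of fun a c => Ψ (Matrix.of fun b d => X (a, b) (c, d)) p.2 q.2) +
        (Matrix.of fun a c => Ψ (Matrix.of fun b d => Y (a, b) (c, d)) p.2 q.2) := by
      ext a c
      exact congrFun (congrFun (map_add Ψ (Matrix.of fun b d => X (a, b) (c, d))
        (Matrix.of fun b d => Y (a, b) (c, d))) p.2) q.2
    exact congrFun (congrFun ((congrArg Φ h).trans (map_add Φ _ _)) p.1) q.1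
  map_smul' r X := by
    ext p q
    have h : (Matrix.of fun a c => Ψ (Matrix.of fun b d => (r • X) (a, b) (c, d)) p.2 q.2 : Op A) =
        r • (Matrix.of fun a c => Ψ (Matrix.of fun b d => X (a, b) (c, d)) p.2 q.2) := by
      ext a c
      exact congrFun (congrFun (map_smul Ψ r (Matrix.of fun b d => X (a, b) (c, d))) p.2) q.2
    exact congrFun (congrFun ((congrArg Φ h).trans (map_smul Φ _ _)) p.1) q.1

/-- On product operators, `(Φ ⊗ Ψ)(X ⊗ Y) = Φ(X) ⊗ Ψ(Y)`. -/
theorem tensorMap_kronecker (Φ : Op A →ₗ[ℂ] Op A') (Ψ : Op B →ₗ[ℂ] Op B') (X : Op A) (Y : Op B) :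
    tensorMap Φ Ψ (Matrix.kronecker X Y) = Matrix.kronecker (Φ X) (Ψ Y) := by
  ext p q
  have h : (Matrix.of fun a c =>
        Ψ (Matrix.of fun b d => Matrix.kronecker X Y (a, b) (c, d)) p.2 q.2 : Op A) =
      Ψ Y p.2 q.2 • X := by
    ext a c
    exact (congrFun (congrFun (map_smul Ψ (X a c) Y) p.2) q.2).trans (mul_comm _ _)
  exact (congrFun (congrFun ((congrArg Φ h).trans (map_smul Φ _ _)) p.1) q.1).trans (mul_comm _ _)

/-- Complete positivity: `Φ ⊗ id_k` preserves positive semidefiniteness for every `k`. -/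
def IsCP (Φ : Op A →ₗ[ℂ] Op A') : Prop :=
  ∀ (k : ℕ) (X : Op (A × Fin k)), X.PosSemidef →
    (tensorMap Φ (LinearMap.id : Op (Fin k) →ₗ[ℂ] Op (Fin k)) X).PosSemidef

variable [Fintype A] [Fintype A'] [Fintype B] [Fintype B']

/-- A quantum channel: completely positive and trace preserving. -/
def IsChannel (Φ : Op A →ₗ[ℂ] Op A') : Prop :=
  IsCP Φ ∧ ∀ X, (Φ X).trace = X.trace

/-- One-way LOCC from the first to the second party: the first party applies an instrument
`{Φ_a}` and sends `a` to the second party, who applies the channel `Ψ_a`. -/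
def IsOneWayRight (Ξ : Op (A × B) →ₗ[ℂ] Op (A' × B')) : Prop :=
  ∃ (m : ℕ) (Φ : Fin m → (Op A →ₗ[ℂ] Op A')) (Ψ : Fin m → (Op B →ₗ[ℂ] Op B')),
    (∀ a, IsCP (Φ a)) ∧ IsChannel (∑ a, Φ a) ∧ (∀ a, IsChannel (Ψ a)) ∧
      Ξ = ∑ a, tensorMap (Φ a) (Ψ a)

/-- One-way LOCC from the second to the first party. -/
def IsOneWayLeft (Ξ : Op (A × B) →ₗ[ℂ] Op (A' × B')) : Prop :=
  ∃ (m : ℕ) (Φ : Fin m → (Op A →ₗ[ℂ] Op A')) (Ψ : Fin m → (Op B →ₗ[ℂ] Op B')),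
    (∀ a, IsChannel (Φ a)) ∧ (∀ a, IsCP (Ψ a)) ∧ IsChannel (∑ a, Ψ a) ∧
      Ξ = ∑ a, tensorMap (Φ a) (Ψ a)

end Channels

/-- LOCC channels `AB → A'B'`: finite compositions of one-way LOCC channels in either direction,
through arbitrary finite-dimensional intermediate systems. -/
inductive IsLOCC {A B : Type} [Fintype A] [Fintype B] :
    ∀ {A' B' : Type} [Fintype A'] [Fintype B'], (Op (A × B) →ₗ[ℂ] Op (A' × B')) → Prop
  | oneWay {A' B' : Type} [Fintype A'] [Fintype B'] {Ξ : Op (A × B) →ₗ[ℂ] Op (A' × B')}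
      (h : IsOneWayRight Ξ ∨ IsOneWayLeft Ξ) : IsLOCC Ξ
  | comp {C D A' B' : Type} [Fintype C] [Fintype D] [Fintype A'] [Fintype B']
      {Ξ : Op (A × B) →ₗ[ℂ] Op (C × D)} {Θ : Op (C × D) →ₗ[ℂ] Op (A' × B')}
      (h : IsLOCC Ξ) (h' : IsOneWayRight Θ ∨ IsOneWayLeft Θ) : IsLOCC (Θ ∘ₗ Ξ)

/-- The closure of the set of LOCC channels `AB → AB`. The closure is taken in the topology of
pointwise convergence, which on the finite-dimensional space of linear maps between matrix
spaces is the usual (norm) topology. -/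
def closedLOCC (A B : Type) [Fintype A] [Fintype B] : Set (Op (A × B) →ₗ[ℂ] Op (A × B)) :=
  {Φ | (Φ : Op (A × B) → Op (A × B)) ∈
    closure ((fun Ψ : Op (A × B) →ₗ[ℂ] Op (A × B) => (Ψ : Op (A × B) → Op (A × B))) ''
      {Ψ | IsLOCC Ψ})}

section Measurements

/-- A positive operator valued measure with outcomes in `ι`. -/
def IsPOVM {S ι : Type} [DecidableEq S] [Fintype ι] (M : ι → Op S) : Prop :=
  (∀ x, (M x).PosSemidef) ∧ ∑ x, M x = 1

/-- A measurement as a channel with classical output: `ρ ↦ ∑ₓ tr(Mₓ ρ) |x⟩⟨x|`. -/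
def measurementChannel {S ι : Type} [Fintype S] [DecidableEq ι] (M : ι → Op S) :
    Op S →ₗ[ℂ] Op ι where
  toFun ρ := Matrix.diagonal fun x => (M x * ρ).trace
  map_add' X Y := by
    ext i j
    by_cases h : i = j <;> simp [h, mul_add]
  map_smul' r X := by
    ext i j
    by_cases h : i = j <;> simp [h]

/-- LOCC measurements of a bipartite system `S : T` with `n` outcomes for each party: POVMs
`{M_{xy}}` whose channel `ρ ↦ ∑_{x,y} tr(M_{xy} ρ) |x⟩⟨x| ⊗ |y⟩⟨y|` is LOCC. -/
def LOCCMeasurements (S T : Type) [Fintype S] [Fintype T] [DecidableEq S] [DecidableEq T]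
    (n : ℕ) : Set (Fin n × Fin n → Op (S × T)) :=
  {M | IsPOVM M ∧ IsLOCC (measurementChannel M)}

/-- The closure of the set of LOCC measurements. -/
def closedLOCCMeasurements (S T : Type) [Fintype S] [Fintype T] [DecidableEq S] [DecidableEq T]
    (n : ℕ) : Set (Fin n × Fin n → Op (S × T)) :=
  closure (LOCCMeasurements S T n)

/-- The quantum relative entropy `D(X‖Y) = tr X log X - tr X log Y` of positive semidefinite
operators, equal to `+∞` unless `ker Y ⊆ ker X`. (Since `Real.log 0 = 0`, the logarithms are
taken on the supports.) -/
noncomputable def relEntropy {S : Type} [Fintype S] [DecidableEq S] (X Y : Op S) : EReal :=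
  open Classical in
  if ∀ v : S → ℂ, Y.mulVec v = 0 → X.mulVec v = 0 then
    (((X * cfc Real.log X).trace.re - (X * cfc Real.log Y).trace.re : ℝ) : EReal)
  else ⊤

/-- The measurement relative entropy `D_m(M‖N) = (1 / dim S) ∑ₓ D(Mₓ‖Nₓ)`. -/
noncomputable def measRelEntropy {S ι : Type} [Fintype S] [DecidableEq S] [Fintype ι]
    (M N : ι → Op S) : EReal :=
  (((Fintype.card S : ℝ)⁻¹ : ℝ) : EReal) * ∑ x, relEntropy (M x) (N x)

/-- The trace dual `Φ†` (Heisenberg picture) of a linear map between matrix spaces. -/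
def dualMap {S T : Type} [Fintype T] [DecidableEq S] (Φ : Op S →ₗ[ℂ] Op T) (Y : Op T) : Op S :=
  Matrix.of fun i j => (Y * Φ (Matrix.single j i 1)).trace

/-- The defining property of the dual: `tr (Φ†(Y) X) = tr (Y Φ(X))`. -/
theorem trace_dualMap_mul {S T : Type} [Fintype S] [Fintype T] [DecidableEq S]
    (Φ : Op S →ₗ[ℂ] Op T) (Y : Op T) (X : Op S) :
    (dualMap Φ Y * X).trace = (Y * Φ X).trace := by
  conv_rhs => rw [Matrix.matrix_eq_sum_single X]
  simp only [map_sum, Matrix.mul_sum, Matrix.trace_sum]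
  rw [Finset.sum_comm]
  simp only [Matrix.trace, Matrix.diag_apply, Matrix.mul_apply (M := dualMap Φ Y)]
  refine Finset.sum_congr rfl fun i _ => Finset.sum_congr rfl fun j _ => ?_
  have h : Matrix.single j i (X j i) = X j i • Matrix.single j i (1 : ℂ) := by
    simp [Matrix.smul_single]
  rw [h, map_smul, Matrix.mul_smul]
  simp [dualMap, Matrix.trace, Finset.mul_sum, mul_comm]

/-- The extension `Φ_{AB} ⊗ id_{CD}` of a map on `AB` by ancillas `C` and `D`, as a map on the
bipartite system `AC : BD`. -/
def withAncilla {A B : Type} (C D : Type) (Φ : Op (A × B) →ₗ[ℂ] Op (A × B)) :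
    Op ((A × C) × (B × D)) →ₗ[ℂ] Op ((A × C) × (B × D)) :=
  let e := Matrix.reindexLinearEquiv ℂ ℂ (Equiv.prodProdProdComm A B C D)
    (Equiv.prodProdProdComm A B C D)
  e.toLinearMap ∘ₗ tensorMap Φ (LinearMap.id : Op (C × D) →ₗ[ℂ] Op (C × D)) ∘ₗ e.symm.toLinearMap

/-- The measurement `M ∘ Φ` that first applies `Φ` and then measures `M`; by duality its POVM
elements are `Φ†(Mₓ)`. -/
def measAfter {S ι : Type} [Fintype S] [DecidableEq S] (M : ι → Op S)
    (Φ : Op S →ₗ[ℂ] Op S) : ι → Op S :=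
  fun x => dualMap Φ (M x)

/-- As channels, the measurement `M ∘ Φ` is the composition of `Φ` and the measurement `M`. -/
theorem measurementChannel_measAfter {S ι : Type} [Fintype S] [DecidableEq S] [DecidableEq ι]
    (M : ι → Op S) (Φ : Op S →ₗ[ℂ] Op S) :
    measurementChannel (measAfter M Φ) = measurementChannel M ∘ₗ Φ := by
  refine LinearMap.ext fun X => ?_
  simp [measurementChannel, measAfter, trace_dualMap_mul]

/-- The measurement-entangling power of a map `Φ` on `AB`,
`inf_F sup_M D_m(M ∘ (Φ ⊗ id) ‖ M ∘ (F ⊗ id))`,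
the infimum over closed-LOCC channels `F` on `A : B` and the supremum over all finite-dimensional
ancillas (of dimensions `k + 1` and `l + 1`) and all closed-LOCC measurements `M` of the extended
bipartite system whose number of outcomes per party lies in `N`. -/
noncomputable def measEntanglingPower {A B : Type} [Fintype A] [Fintype B] [DecidableEq A]
    [DecidableEq B] (N : Set ℕ) (Φ : Op (A × B) →ₗ[ℂ] Op (A × B)) : EReal :=
  ⨅ F ∈ closedLOCC A B, ⨆ (k : ℕ) (l : ℕ), ⨆ n ∈ N,
    ⨆ M ∈ closedLOCCMeasurements (A × Fin (k + 1)) (B × Fin (l + 1)) n,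
      measRelEntropy (measAfter M (withAncilla (Fin (k + 1)) (Fin (l + 1)) Φ))
        (measAfter M (withAncilla (Fin (k + 1)) (Fin (l + 1)) F))

end Measurements

end QuantumResource

open QuantumResource

/-! The analytic core is a variational description of the relative entropy. Up to a boundary term
fixed by the trace, $D(X\Vert Y)$ is the integral over $s>0$ of $\sum_p w_p x_p^2/(s x_p+y_p)$,
where the $x_p,y_p$ are eigenvalues and the $w_p$ are squared eigenvector overlaps. For each $s$
this sum is the maximum over $Z$ of `entropyForm s X Y Z`, which is linear in $(X,Y)$. Domination of
these maxima therefore yields domination of relative entropies (`sum_log_le_of_forall_sum_div_le`,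
`relEntropy_le_of_forall_entropyForm_le`). Linearity of the form gives joint convexity
(`relEntropy_convex`). Replacing $Z$ by $\Phi(Z)$ and applying the Kadison-Schwarz inequality gives
data processing for duals of unital completely positive maps (`relEntropy_dualMap_le`).

Monotonicity: for a competitor $F$ of $\Phi$, the map $K\circ F\circ L$ competes with
$K\circ\Phi\circ L$. The outer $K$ is absorbed into the measurement, which stays closed-LOCC, and
the unital $L$ is removed by data processing (`measDivergence_comp_le`).

Convexity: nearly optimal competitors are mixed. The mixture is closed-LOCC by shared randomness
(`IsLOCC.convex`), and $D_m$ is jointly convex.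

Non-negativity and faithfulness: Klein's inequality with a quadratic remainder, summed over
outcomes, bounds $D_m$ below by squared entrywise distances, the trace terms cancelling for POVMs
(`sum_trace_sq_le_measRelEntropy`). If the power vanishes, some closed-LOCC sequence has divergence
from $\Phi$ tending to zero. Local product measurements already determine a map, so the sequence
converges to $\Phi$, and closedness concludes. -/

namespace QuantumResource

/-! ### Scalar inequalities for logarithms -/

open Filter Topology in
/-- If the quadratic forms `∑ w x² / (s x + y)` of two weighted families of pairs are ordered for
all `s > 0`, so are their relative entropies. -/
theorem sum_log_le_of_forall_sum_div_le {α β : Type*} [Fintype α] [Fintype β]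
    {w x y : α → ℝ} {w' x' y' : β → ℝ}
    (hw : ∀ a, 0 ≤ w a) (hx : ∀ a, 0 ≤ x a) (hy : ∀ a, 0 ≤ y a)
    (hx' : ∀ a, 0 ≤ x' a) (hy' : ∀ a, 0 ≤ y' a)
    (hw' : ∀ a, 0 ≤ w' a)
    (hQ : ∀ s : ℝ, 0 < s → ∑ a, w a * (x a ^ 2 / (s * x a + y a)) ≤
      ∑ b, w' b * (x' b ^ 2 / (s * x' b + y' b)))
    (htr : ∑ a, w a * x a = ∑ b, w' b * x' b)
    (hk : ∀ b, y' b = 0 → w' b * x' b = 0) :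
    (∀ a, y a = 0 → w a * x a = 0) ∧
      ∑ a, w a * (x a * (Real.log (x a) - Real.log (y a))) ≤
        ∑ b, w' b * (x' b * (Real.log (x' b) - Real.log (y' b))) := by
  have hk1 : ∀ a, y a = 0 → w a * x a = 0 := by
    intro a ha
    -- This bounds the right-hand form for every `s > 0`; terms with `y' b = 0` vanish on both
    -- sides, by `hk` and by division by zero being zero. Where `y a = 0` the left term is `w a * x
    -- a / s`, so letting `s` tend to zero forces `w a * x a = 0`.
    set c := ∑ b, w' b * (x' b ^ 2 / y' b) with hc
    have key : ∀ s : ℝ, 0 < s → w a * x a ≤ s * c := by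
      intro s hs
      have h1 : w a * (x a ^ 2 / (s * x a + y a)) ≤ c := by
        refine le_trans (Finset.single_le_sum (f := fun a => w a * (x a ^ 2 / (s * x a + y a)))
          (fun i _ => ?_) (Finset.mem_univ a)) ((hQ s hs).trans ?_)
        · have := hw i; have := hx i; have := hy i; positivity
        · refine Finset.sum_le_sum fun b _ => ?_
          rcases (hy' b).eq_or_lt with h | h
          · have : w' b * (x' b ^ 2 / (s * x' b + y' b)) =
              (w' b * x' b) * (x' b / (s * x' b + y' b)) := by ring
            rw [this, hk b h.symm, ← h]; simp
          · have := hx' b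
            have := hw' b
            gcongr
            nlinarith
      rcases (hx a).eq_or_lt with h | h
      · have : 0 ≤ c := le_trans (by rw [← h]; simp) h1
        rw [← h]; simp; positivity
      · rw [ha, add_zero] at h1
        have : w a * x a = s * (w a * (x a ^ 2 / (s * x a))) := by field_simp
        rw [this]
        gcongr
    refine le_antisymm ?_ (mul_nonneg (hw a) (hx a))
    have ht : Tendsto (fun s : ℝ => s * c) (𝓝[>] 0) (𝓝 0) := by
      have : Tendsto (fun s : ℝ => s * c) (𝓝 0) (𝓝 (0 * c)) := tendsto_id.mul_const c
      rw [zero_mul] at this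
      exact this.mono_left nhdsWithin_le_nhds
    exact ge_of_tendsto ht (by filter_upwards [self_mem_nhdsWithin] with s hs using key s hs)
  refine ⟨hk1, ?_⟩
  -- The derivative of `w * x * log (R * x + y)` in `R` is `w * (x ^ 2 / (R * x + y))`. By `hQ` the
  -- difference of the two logarithmic sums is thus nondecreasing, and the claim compares `R = 0`
  -- with `R → ∞`.
  have mono : ∀ R : ℝ, 0 ≤ R →
      ∑ b, w' b * x' b * Real.log (y' b) - ∑ a, w a * x a * Real.log (y a) ≤
      ∑ b, w' b * x' b * Real.log (R * x' b + y' b) -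
        ∑ a, w a * x a * Real.log (R * x a + y a) := by
    have cont : ∀ (w x y : ℝ), 0 ≤ x → 0 ≤ y → (y = 0 → w * x = 0) →
        ContinuousOn (fun R : ℝ => w * x * Real.log (R * x + y)) (Set.Ici 0) := by
      intro w x y hx hy h
      rcases hy.eq_or_lt with h0 | h0
      · rw [h h0.symm]; simp [continuousOn_const]
      · refine ContinuousOn.mul continuousOn_const (ContinuousOn.log (by fun_prop) ?_)
        intro R hR
        have : 0 ≤ R := hR
        positivity
    have der : ∀ (w x y : ℝ), 0 ≤ x → 0 ≤ y → (y = 0 → w * x = 0) → ∀ R : ℝ, 0 < R →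
        HasDerivAt (fun R : ℝ => w * x * Real.log (R * x + y)) (w * (x ^ 2 / (R * x + y))) R := by
      intro w x y hx hy h R hR
      rcases hy.eq_or_lt with h0 | h0
      · have : w * (x ^ 2 / (R * x + y)) = (w * x) * (x / (R * x + y)) := by ring
        rw [this, h h0.symm]; simp [hasDerivAt_const]
      · have h1 : HasDerivAt (fun R : ℝ => R * x + y) x R := by
          simpa using ((hasDerivAt_id R).mul_const x).add_const y
        exact ((h1.log (by positivity)).const_mul (w * x)).congr_deriv (by ring)
    intro R hR
    have hm := monotoneOn_of_deriv_nonneg (convex_Ici (0 : ℝ))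
      (f := fun R => ∑ b, w' b * x' b * Real.log (R * x' b + y' b) -
        ∑ a, w a * x a * Real.log (R * x a + y a)) ?_ ?_ ?_
    · simpa using hm (Set.mem_Ici.2 le_rfl) (Set.mem_Ici.2 hR) hR
    · exact (continuousOn_finsetSum _ fun b _ => cont _ _ _ (hx' b) (hy' b) (hk b)).sub
        (continuousOn_finsetSum _ fun b _ => cont _ _ _ (hx b) (hy b) (hk1 b))
    · intro r hr
      rw [interior_Ici] at hr
      exact ((HasDerivAt.fun_sum fun b _ => der _ _ _ (hx' b) (hy' b) (hk b) r hr).sub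
        (HasDerivAt.fun_sum fun b _ =>
          der _ _ _ (hx b) (hy b) (hk1 b) r hr)).differentiableAt.differentiableWithinAt
    · intro r hr
      rw [interior_Ici] at hr
      have := ((HasDerivAt.fun_sum (u := Finset.univ)
          fun b _ => der _ _ _ (hx' b) (hy' b) (hk b) r hr).sub
        (HasDerivAt.fun_sum (u := Finset.univ) fun b _ =>
          der _ _ _ (hx b) (hy b) (hk1 b) r hr)).deriv
      have h2 := hQ r hr
      refine le_of_le_of_eq (sub_nonneg.2 h2) this.symm
  -- Subtracting `log R` makes each term converge; the subtracted terms cancel between the two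
  -- families because of `htr`.
  have lim : ∀ (w x y : ℝ), 0 ≤ x →
      Tendsto (fun R : ℝ => w * x * (Real.log (R * x + y) - Real.log R)) atTop
        (𝓝 (w * x * Real.log x)) := by
    intro w x y hx
    rcases hx.eq_or_lt with h0 | h0
    · rw [← h0]; simp
    · refine Tendsto.const_mul _ ?_
      have h1 : Tendsto (fun R : ℝ => Real.log (x + y / R)) atTop (𝓝 (Real.log x)) := by
        refine Tendsto.log ?_ h0.ne'
        simpa using (tendsto_const_nhds (x := x)).add
          ((tendsto_const_nhds (x := y)).div_atTop tendsto_id)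
      refine h1.congr' ?_
      have h2 : ∀ᶠ R : ℝ in atTop, 0 < R * x + y := by
        have : Tendsto (fun R : ℝ => R * x + y) atTop atTop :=
          tendsto_atTop_add_const_right _ _ (tendsto_id.atTop_mul_const h0)
        exact this.eventually_gt_atTop 0
      filter_upwards [h2, eventually_gt_atTop 0] with R h3 h4
      rw [← Real.log_div h3.ne' h4.ne']
      congr 1
      field_simp
  have hlim := (tendsto_finsetSum Finset.univ fun b _ => lim (w' b) (x' b) (y' b) (hx' b)).sub
    (tendsto_finsetSum Finset.univ fun b _ => lim (w b) (x b) (y b) (hx b))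
  have := ge_of_tendsto hlim (b := ∑ b, w' b * x' b * Real.log (y' b) -
    ∑ a, w a * x a * Real.log (y a)) (by
      filter_upwards [eventually_ge_atTop 0] with R hR
      refine (mono R hR).trans_eq ?_
      simp only [mul_sub, Finset.sum_sub_distrib, ← Finset.sum_mul]
      rw [htr]; ring)
  simp only [mul_sub, Finset.sum_sub_distrib, ← mul_assoc]
  linarith

/-- Scalar form of the strengthened Klein inequality. -/
theorem sq_sub_div_four_le_mul_log_sub {x y : ℝ} (hx : 0 ≤ x) (hx1 : x ≤ 1) (hy : 0 ≤ y)
    (hy1 : y ≤ 1) (h : y = 0 → x = 0) :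
    (x - y) ^ 2 / 4 ≤ x * (Real.log x - Real.log y) - x + y := by
  rcases hy.eq_or_lt with h0 | h0
  · rw [h h0.symm, ← h0]; simp
  rcases hx.eq_or_lt with h1 | h1
  · rw [← h1]; nlinarith
  have hsx := Real.sqrt_pos.2 h1
  have hsy := Real.sqrt_pos.2 h0
  -- Using `log t ≤ t - 1` at `√y / √x` rather than at `y / x` leaves the remainder `(√x - √y) ^ 2`
  -- instead of zero. The factor 4 then comes from `√x + √y ≤ 2`.
  have h2 := Real.log_le_sub_one_of_pos (div_pos hsy hsx)
  rw [Real.log_div hsy.ne' hsx.ne', Real.log_sqrt hx, Real.log_sqrt hy] at h2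
  have h3 : x * (√y / √x - 1) = √x * √y - x := by
    have := Real.mul_self_sqrt hx
    field_simp
    nlinarith
  have h4 := mul_le_mul_of_nonneg_left h2 hx
  have e1 := Real.sq_sqrt hx
  have e2 := Real.sq_sqrt hy
  have l1 : √x ≤ 1 := Real.sqrt_le_one.2 hx1
  have l2 : √y ≤ 1 := Real.sqrt_le_one.2 hy1
  have h5 : (x - y) ^ 2 ≤ 4 * (√x - √y) ^ 2 := by
    have : (x - y) ^ 2 = (√x - √y) ^ 2 * (√x + √y) ^ 2 := by
      rw [← mul_pow]; congr 1; nlinarith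
    rw [this]
    have : (√x + √y) ^ 2 ≤ 4 := by nlinarith
    nlinarith [sq_nonneg (√x - √y)]
  nlinarith

/-! ### Joint spectral description of two positive operators -/

section Spectral

variable {S : Type} [Fintype S] [DecidableEq S]

/-- The operator with eigenbasis the columns of `U` and eigenvalues `x`. -/
def ofSpectrum (U : Op S) (x : S → ℝ) : Op S :=
  U * Matrix.diagonal (fun i => (x i : ℂ)) * U.conjTranspose

theorem exists_ofSpectrum {X : Op S} (hX : X.IsHermitian) :
    ∃ (U : Op S) (x : S → ℝ), U.conjTranspose * U = 1 ∧ U * U.conjTranspose = 1 ∧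
      (X.PosSemidef → ∀ i, 0 ≤ x i) ∧ X = ofSpectrum U x ∧
      ∀ f : ℝ → ℝ, cfc f X = ofSpectrum U fun i => f (x i) := by
  refine ⟨hX.eigenvectorUnitary, hX.eigenvalues, ?_, ?_, fun h => h.eigenvalues_nonneg, ?_, ?_⟩
  · rw [← Matrix.star_eq_conjTranspose]; exact Unitary.coe_star_mul_self _
  · rw [← Matrix.star_eq_conjTranspose]; exact Unitary.coe_mul_star_self _
  · exact hX.spectral_theorem
  · intro f
    rw [hX.cfc_eq f]
    rfl

theorem trace_ofSpectrum_mul (U V : Op S) (x y : S → ℝ) :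
    (ofSpectrum U x * ofSpectrum V y).trace =
      ((∑ p : S × S, Complex.normSq ((U.conjTranspose * V) p.1 p.2) * (x p.1 * y p.2) : ℝ) : ℂ) := by
  set W := U.conjTranspose * V with hW
  have h1 : (ofSpectrum U x * ofSpectrum V y).trace =
      (Matrix.diagonal (fun i => (x i : ℂ)) * W * Matrix.diagonal (fun i => (y i : ℂ)) *
        W.conjTranspose).trace := by
    simp only [ofSpectrum, hW, Matrix.conjTranspose_mul, Matrix.conjTranspose_conjTranspose,
      Matrix.mul_assoc]
    rw [Matrix.trace_mul_comm]
    simp only [Matrix.mul_assoc]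
  rw [h1, Fintype.sum_prod_type]
  simp only [Matrix.trace, Matrix.diag_apply]
  push_cast
  refine Finset.sum_congr rfl fun i _ => ?_
  rw [Matrix.mul_apply]
  refine Finset.sum_congr rfl fun j _ => ?_
  rw [Matrix.mul_diagonal, Matrix.diagonal_mul, Matrix.conjTranspose_apply,
    Complex.normSq_eq_conj_mul_self]
  simp only [Complex.star_def]
  ring

/-- The functional `2 Re tr(Z† X) - s tr(Z X Z†) - tr(Z† Y Z)`, linear in `(X, Y)`. -/
noncomputable def entropyForm (s : ℝ) (X Y Z : Op S) : ℝ :=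
  2 * (Z.conjTranspose * X).trace.re - s * (Z * X * Z.conjTranspose).trace.re -
    (Z.conjTranspose * Y * Z).trace.re

/-- Writing `Z` as `V * C * U†` decouples the form: each entry of `C` appears in one summand only,
so maximizing over `Z` reduces to scalar quadratic problems. -/
theorem entropyForm_ofSpectrum {U V : Op S} (hU : U.conjTranspose * U = 1)
    (hV : V.conjTranspose * V = 1) (x y : S → ℝ) (s : ℝ) (C : Op S) :
    entropyForm s (ofSpectrum U x) (ofSpectrum V y) (V * C * U.conjTranspose) =
      ∑ p : S × S, (2 * x p.1 * (C p.2 p.1 * (U.conjTranspose * V) p.1 p.2).re -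
        (s * x p.1 + y p.2) * Complex.normSq (C p.2 p.1)) := by
  set W := U.conjTranspose * V with hW
  have hWc : W.conjTranspose = V.conjTranspose * U := by simp [hW]
  have cU : ∀ M : Op S, U.conjTranspose * (U * M) = M := fun M => by
    rw [← Matrix.mul_assoc, hU, Matrix.one_mul]
  have cV : ∀ M : Op S, V.conjTranspose * (V * M) = M := fun M => by
    rw [← Matrix.mul_assoc, hV, Matrix.one_mul]
  have t1 : ((V * C * U.conjTranspose).conjTranspose * ofSpectrum U x).trace =
      (C.conjTranspose * W.conjTranspose * Matrix.diagonal (fun i => (x i : ℂ))).trace := by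
    simp only [ofSpectrum, hWc, Matrix.conjTranspose_mul, Matrix.conjTranspose_conjTranspose,
      Matrix.mul_assoc]
    rw [Matrix.trace_mul_comm]
    simp only [Matrix.mul_assoc, hU, Matrix.mul_one]
  have t2 : ((V * C * U.conjTranspose) * ofSpectrum U x *
      (V * C * U.conjTranspose).conjTranspose).trace =
      (C * Matrix.diagonal (fun i => (x i : ℂ)) * C.conjTranspose).trace := by
    simp only [ofSpectrum, Matrix.conjTranspose_mul, Matrix.conjTranspose_conjTranspose,
      Matrix.mul_assoc]
    rw [Matrix.trace_mul_comm]
    simp only [Matrix.mul_assoc, cU, hV, Matrix.mul_one]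
  have t3 : ((V * C * U.conjTranspose).conjTranspose * ofSpectrum V y *
      (V * C * U.conjTranspose)).trace =
      (C.conjTranspose * Matrix.diagonal (fun i => (y i : ℂ)) * C).trace := by
    simp only [ofSpectrum, Matrix.conjTranspose_mul, Matrix.conjTranspose_conjTranspose,
      Matrix.mul_assoc]
    rw [Matrix.trace_mul_comm]
    simp only [Matrix.mul_assoc, cV, hU, Matrix.mul_one]
  have e1 : (C.conjTranspose * W.conjTranspose * Matrix.diagonal (fun i => (x i : ℂ))).trace.re =
      ∑ i, ∑ j, x i * (C j i * W i j).re := by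
    simp only [Matrix.trace, Matrix.diag_apply, Matrix.mul_diagonal]
    simp only [Matrix.mul_apply, Matrix.conjTranspose_apply, Complex.re_sum, Finset.sum_mul,
      Complex.star_def]
    refine Finset.sum_congr rfl fun i _ => Finset.sum_congr rfl fun j _ => ?_
    rw [← map_mul, Complex.re_mul_ofReal, Complex.conj_re]
    ring
  have e2 : (C * Matrix.diagonal (fun i => (x i : ℂ)) * C.conjTranspose).trace.re =
      ∑ i, ∑ j, x i * Complex.normSq (C j i) := by
    rw [Finset.sum_comm]
    simp only [Matrix.trace, Matrix.diag_apply, Matrix.mul_apply (N := C.conjTranspose),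
      Matrix.mul_diagonal,
      Matrix.conjTranspose_apply, Complex.re_sum, Complex.star_def]
    refine Finset.sum_congr rfl fun i _ => Finset.sum_congr rfl fun j _ => ?_
    rw [mul_right_comm, Complex.mul_conj, ← Complex.ofReal_mul, Complex.ofReal_re, mul_comm]
  have e3 : (C.conjTranspose * Matrix.diagonal (fun i => (y i : ℂ)) * C).trace.re =
      ∑ i, ∑ j, y j * Complex.normSq (C j i) := by
    simp only [Matrix.trace, Matrix.diag_apply, Matrix.mul_apply (N := C),
      Matrix.mul_diagonal,
      Matrix.conjTranspose_apply, Complex.re_sum, Complex.star_def]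
    refine Finset.sum_congr rfl fun i _ => Finset.sum_congr rfl fun j _ => ?_
    rw [mul_right_comm, ← Complex.normSq_eq_conj_mul_self, ← Complex.ofReal_mul,
      Complex.ofReal_re, mul_comm]
  rw [entropyForm, t1, t2, t3, e1, e2, e3, Fintype.sum_prod_type]
  simp only [Finset.mul_sum, ← Finset.sum_sub_distrib]
  refine Finset.sum_congr rfl fun i _ => Finset.sum_congr rfl fun j _ => ?_
  ring

/-- Simultaneous spectral description of two positive operators `X = ∑ᵢ xᵢ |uᵢ⟩⟨uᵢ|` and
`Y = ∑ⱼ yⱼ |vⱼ⟩⟨vⱼ|`: the weights are `|⟨uᵢ|vⱼ⟩|²`. -/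
structure JointSpectrum (X Y : Op S) where
  /-- overlaps of the eigenvectors -/
  w : S × S → ℝ
  /-- eigenvalues of the first operator -/
  x : S × S → ℝ
  /-- eigenvalues of the second operator -/
  y : S × S → ℝ
  w_nonneg : ∀ p, 0 ≤ w p
  x_nonneg : ∀ p, 0 ≤ x p
  y_nonneg : ∀ p, 0 ≤ y p
  trace_left : X.trace.re = ∑ p, w p * x p
  trace_right : Y.trace.re = ∑ p, w p * y p
  entropy_eq : (X * cfc Real.log X).trace.re - (X * cfc Real.log Y).trace.re =
    ∑ p, w p * (x p * (Real.log (x p) - Real.log (y p)))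
  ker_iff : (∀ v : S → ℂ, Y.mulVec v = 0 → X.mulVec v = 0) ↔ ∀ p, y p = 0 → w p * x p = 0
  form_le : ∀ s : ℝ, 0 < s → ∀ Z,
    entropyForm s X Y Z ≤ ∑ p, w p * (x p ^ 2 / (s * x p + y p))
  exists_form_eq : ∀ s : ℝ, 0 < s → ∃ Z,
    entropyForm s X Y Z = ∑ p, w p * (x p ^ 2 / (s * x p + y p))
  trace_sq : ((X - Y) * (X - Y)).trace.re = ∑ p, w p * (x p - y p) ^ 2
  x_le_one : (1 - X).PosSemidef → ∀ p, x p ≤ 1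
  y_le_one : (1 - Y).PosSemidef → ∀ p, y p ≤ 1

theorem le_one_of_one_sub_ofSpectrum {U : Op S} (hU : U.conjTranspose * U = 1) {x : S → ℝ}
    (h : (1 - ofSpectrum U x).PosSemidef) (i : S) : x i ≤ 1 := by
  have h1 := (h.conjTranspose_mul_mul_same U).diag_nonneg (i := i)
  have h2 : U.conjTranspose * (1 - ofSpectrum U x) * U =
      1 - Matrix.diagonal (fun i => (x i : ℂ)) := by
    simp only [ofSpectrum, Matrix.mul_sub, Matrix.sub_mul, Matrix.mul_one, hU]
    rw [show U.conjTranspose * (U * Matrix.diagonal (fun i => (x i : ℂ)) * U.conjTranspose) * U =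
      (U.conjTranspose * U) * Matrix.diagonal (fun i => (x i : ℂ)) * (U.conjTranspose * U) by
      simp only [Matrix.mul_assoc], hU, Matrix.one_mul, Matrix.mul_one]
  rw [h2] at h1
  simp only [Matrix.sub_apply, Matrix.one_apply_eq, Matrix.diagonal_apply_eq] at h1
  rw [← Complex.ofReal_one, ← Complex.ofReal_sub] at h1
  have := Complex.zero_le_real.1 h1
  linarith

/-- Completing the square: the defect is `|(s x + y) c - x w̄|²` divided by `s x + y`. -/
theorem scalar_form_le {s x y : ℝ} (hs : 0 < s) (hx : 0 ≤ x) (hy : 0 ≤ y) (c w : ℂ) :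
    2 * x * (c * w).re - (s * x + y) * Complex.normSq c ≤
      Complex.normSq w * (x ^ 2 / (s * x + y)) := by
  rcases hx.eq_or_lt with h | h
  · rw [← h]
    simp only [mul_zero, zero_mul, zero_add, ne_eq, OfNat.ofNat_ne_zero, not_false_eq_true,
      zero_pow, zero_div, zero_sub, neg_nonpos]
    exact mul_nonneg hy (Complex.normSq_nonneg c)
  · have ht : 0 < s * x + y := by positivity
    rw [← mul_div_assoc, le_div_iff₀ ht]
    have := Complex.normSq_nonneg ((s * x + y : ℝ) * c - x * (starRingEnd ℂ) w)
    rw [Complex.normSq_sub] at this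
    simp only [Complex.normSq_ofReal, Complex.normSq_conj, map_mul,
      Complex.conj_ofReal, Complex.conj_conj] at this
    rw [show ((s * x + y : ℝ) : ℂ) * c * (x * w) = (((s * x + y) * x : ℝ) : ℂ) * (c * w) by
      push_cast; ring, Complex.re_ofReal_mul] at this
    nlinarith

/-- The maximizer is the point where the completed square vanishes. When `x = 0` it is zero, even if
the denominator vanishes. -/
theorem scalar_form_eq {s x y : ℝ} (hs : 0 < s) (hx : 0 ≤ x) (hy : 0 ≤ y) (w : ℂ) :
    2 * x * (((x / (s * x + y) : ℝ) * (starRingEnd ℂ) w) * w).re -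
      (s * x + y) * Complex.normSq ((x / (s * x + y) : ℝ) * (starRingEnd ℂ) w) =
      Complex.normSq w * (x ^ 2 / (s * x + y)) := by
  rw [mul_assoc ((x / (s * x + y) : ℝ) : ℂ), ← Complex.normSq_eq_conj_mul_self,
    ← Complex.ofReal_mul, Complex.ofReal_re, Complex.normSq_mul, Complex.normSq_ofReal,
    Complex.normSq_conj]
  rcases hx.eq_or_lt with h | h
  · simp [← h]
  · have ht : 0 < s * x + y := by positivity
    field_simp
    ring

/-- One direction tests the eigenvectors `V eⱼ` with `y j = 0`. Conversely, a kernel vector has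
`V`-coordinates supported where `y` vanishes, and there every product of overlap and `x i` is zero.
-/
theorem ker_iff_ofSpectrum {U V : Op S} (hU : U.conjTranspose * U = 1)
    (hV : V.conjTranspose * V = 1) (hV' : V * V.conjTranspose = 1) (x y : S → ℝ) :
    (∀ v : S → ℂ, (ofSpectrum V y).mulVec v = 0 → (ofSpectrum U x).mulVec v = 0) ↔
      ∀ p : S × S, y p.2 = 0 →
        Complex.normSq ((U.conjTranspose * V) p.1 p.2) * x p.1 = 0 := by
  constructor
  · intro h p hp
    have h1 : (ofSpectrum V y).mulVec (V.mulVec (Pi.single p.2 1)) = 0 := by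
      rw [Matrix.mulVec_mulVec, ofSpectrum, Matrix.mul_assoc, hV, Matrix.mul_one,
        ← Matrix.mulVec_mulVec, Matrix.mulVec_single_one]
      have : (Matrix.diagonal fun i => (y i : ℂ)).col p.2 = 0 := by
        ext i
        by_cases hi : i = p.2 <;> simp [Matrix.col, hi, hp]
      rw [this, Matrix.mulVec_zero]
    have h2 := congrArg (fun v => U.conjTranspose.mulVec v p.1) (h _ h1)
    simp only [Matrix.mulVec_mulVec, Matrix.mulVec_zero, Pi.zero_apply, ofSpectrum] at h2
    rw [Matrix.mul_assoc U, ← Matrix.mul_assoc, ← Matrix.mul_assoc, hU, Matrix.one_mul,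
      Matrix.mul_assoc, Matrix.mulVec_single_one, Matrix.col_apply, Matrix.diagonal_mul] at h2
    rcases mul_eq_zero.1 h2 with h3 | h3
    · simp only [Complex.ofReal_eq_zero] at h3
      simp [h3]
    · simp [h3]
  · intro h v hv
    have h1 : ∀ j, (y j : ℂ) * V.conjTranspose.mulVec v j = 0 := by
      intro j
      have h2 := congrArg (fun v => V.conjTranspose.mulVec v j) hv
      simp only [Matrix.mulVec_mulVec, Matrix.mulVec_zero, Pi.zero_apply, ofSpectrum] at h2
      rw [← Matrix.mul_assoc, ← Matrix.mul_assoc, hV, Matrix.one_mul,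
        ← Matrix.mulVec_mulVec, Matrix.mulVec_diagonal] at h2
      exact h2
    have h3 : (ofSpectrum U x).mulVec v = U.mulVec
        ((Matrix.diagonal (fun i => (x i : ℂ)) * (U.conjTranspose * V)).mulVec
          (V.conjTranspose.mulVec v)) := by
      simp only [Matrix.mulVec_mulVec, Matrix.mul_assoc, hV', Matrix.mul_one, ofSpectrum]
    rw [h3]
    have h4 : (Matrix.diagonal (fun i => (x i : ℂ)) * (U.conjTranspose * V)).mulVec
          (V.conjTranspose.mulVec v) = 0 := by
      ext i
      rw [Matrix.mulVec, dotProduct]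
      refine Finset.sum_eq_zero fun j _ => ?_
      rw [Matrix.diagonal_mul]
      rcases mul_eq_zero.1 (h1 j) with h5 | h5
      · have := h (i, j) (by simpa using h5)
        rcases mul_eq_zero.1 this with h6 | h6
        · rw [Complex.normSq_eq_zero.1 h6]; simp
        · simp only at h6
          simp [h6]
      · rw [h5, mul_zero]
    rw [h4, Matrix.mulVec_zero]

theorem nonempty_jointSpectrum {X Y : Op S} (hX : X.PosSemidef) (hY : Y.PosSemidef) :
    Nonempty (JointSpectrum X Y) := by
  obtain ⟨U, x, hU, hU', hx, hXs, hXf⟩ := exists_ofSpectrum hX.1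
  replace hx := hx hX
  obtain ⟨V, y, hV, hV', hy, hYs, hYf⟩ := exists_ofSpectrum hY.1
  replace hy := hy hY
  -- The identity has constant spectrum in either basis, so traces of a single operator become sums
  -- with the same overlap weights.
  have one_left : ofSpectrum U (fun _ => 1) = 1 := by simp [ofSpectrum, hU']
  have one_right : ofSpectrum V (fun _ => 1) = 1 := by simp [ofSpectrum, hV']
  have sq : ∀ (U : Op S) (_ : U.conjTranspose * U = 1) (a b : S → ℝ),
      ofSpectrum U a * ofSpectrum U b = ofSpectrum U fun i => a i * b i := by
    intro U hU a b
    simp only [ofSpectrum, Matrix.mul_assoc]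
    rw [← Matrix.mul_assoc U.conjTranspose, hU, Matrix.one_mul,
      ← Matrix.mul_assoc (Matrix.diagonal _), Matrix.diagonal_mul_diagonal]
    simp
  have trl : ∀ a : S → ℝ, (ofSpectrum U a).trace.re =
      ∑ p : S × S, Complex.normSq ((U.conjTranspose * V) p.1 p.2) * a p.1 := by
    intro a
    have := trace_ofSpectrum_mul U V a fun _ => 1
    rw [one_right, Matrix.mul_one] at this
    rw [this, Complex.ofReal_re]; simp
  have trr : ∀ a : S → ℝ, (ofSpectrum V a).trace.re =
      ∑ p : S × S, Complex.normSq ((U.conjTranspose * V) p.1 p.2) * a p.2 := by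
    intro a
    have := trace_ofSpectrum_mul U V (fun _ => 1) a
    rw [one_left, Matrix.one_mul] at this
    rw [this, Complex.ofReal_re]; simp
  refine ⟨⟨fun p => Complex.normSq ((U.conjTranspose * V) p.1 p.2), fun p => x p.1,
    fun p => y p.2, fun _ => Complex.normSq_nonneg _, fun p => hx p.1, fun p => hy p.2,
    ?_, ?_, ?_, ?_, ?_, ?_, ?_, ?_, ?_⟩⟩
  · rw [hXs, trl]
  · rw [hYs, trr]
  · rw [hXf, hYf]
    conv_lhs => rw [hXs]
    rw [sq U hU, trl, trace_ofSpectrum_mul, Complex.ofReal_re, ← Finset.sum_sub_distrib]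
    refine Finset.sum_congr rfl fun p _ => ?_
    ring
  · rw [hXs, hYs]; exact ker_iff_ofSpectrum hU hV hV' x y
  · intro s hs Z
    have : Z = V * (V.conjTranspose * Z * U) * U.conjTranspose := by
      simp only [Matrix.mul_assoc, hU', Matrix.mul_one]
      rw [← Matrix.mul_assoc, hV', Matrix.one_mul]
    rw [this, hXs, hYs, entropyForm_ofSpectrum hU hV]
    exact Finset.sum_le_sum fun p _ => scalar_form_le hs (hx _) (hy _) _ _
  · intro s hs
    refine ⟨V * (Matrix.of fun j i => ((x i / (s * x i + y j) : ℝ) : ℂ) *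
      (starRingEnd ℂ) ((U.conjTranspose * V) i j)) * U.conjTranspose, ?_⟩
    rw [hXs, hYs, entropyForm_ofSpectrum hU hV]
    exact Finset.sum_congr rfl fun p _ => scalar_form_eq hs (hx _) (hy _) _
  · have : ((X - Y) * (X - Y)).trace = (X * X).trace - 2 * (X * Y).trace + (Y * Y).trace := by
      simp only [Matrix.mul_sub, Matrix.sub_mul, Matrix.trace_sub]
      rw [Matrix.trace_mul_comm Y X]
      ring
    rw [this, Complex.add_re, Complex.sub_re, hXs, hYs, sq U hU, sq V hV, trl, trr,
      trace_ofSpectrum_mul, ← Complex.ofReal_ofNat, ← Complex.ofReal_mul, Complex.ofReal_re,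
      Finset.mul_sum, ← Finset.sum_sub_distrib, ← Finset.sum_add_distrib]
    refine Finset.sum_congr rfl fun p _ => ?_
    ring
  · intro h p; rw [hXs] at h; exact le_one_of_one_sub_ofSpectrum hU h _
  · intro h p; rw [hYs] at h; exact le_one_of_one_sub_ofSpectrum hV h _

end Spectral

/-! ### Relative entropy: comparison, joint convexity, Klein inequality -/

section RelEntropy

variable {S : Type} [Fintype S] [DecidableEq S]

theorem relEntropy_self (X : Op S) : relEntropy X X = 0 := by
  simp [relEntropy]

open Classical in
theorem JointSpectrum.relEntropy_eq {X Y : Op S} (J : JointSpectrum X Y) :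
    relEntropy X Y = if ∀ p, J.y p = 0 → J.w p * J.x p = 0 then
      ((∑ p, J.w p * (J.x p * (Real.log (J.x p) - Real.log (J.y p))) : ℝ) : EReal) else ⊤ := by
  unfold relEntropy
  rw [J.entropy_eq]
  exact if_congr J.ker_iff rfl rfl

/-- Domination of the forms `entropyForm` implies domination of the relative entropies. -/
theorem relEntropy_le_of_forall_entropyForm_le {T : Type} [Fintype T] [DecidableEq T]
    {X Y : Op S} {X' Y' : Op T} (hX : X.PosSemidef) (hY : Y.PosSemidef) (hX' : X'.PosSemidef)
    (hY' : Y'.PosSemidef) (htr : X.trace = X'.trace)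
    (h : ∀ s : ℝ, 0 < s → ∀ Z, ∃ Z', entropyForm s X Y Z ≤ entropyForm s X' Y' Z') :
    relEntropy X Y ≤ relEntropy X' Y' := by
  obtain ⟨J⟩ := nonempty_jointSpectrum hX hY
  obtain ⟨J'⟩ := nonempty_jointSpectrum hX' hY'
  rw [J.relEntropy_eq, J'.relEntropy_eq]
  by_cases hk : ∀ p, J'.y p = 0 → J'.w p * J'.x p = 0
  · obtain ⟨h1, h2⟩ := sum_log_le_of_forall_sum_div_le J.w_nonneg J.x_nonneg J.y_nonneg
      J'.x_nonneg J'.y_nonneg J'.w_nonneg (fun s hs => by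
        obtain ⟨Z, hZ⟩ := J.exists_form_eq s hs
        obtain ⟨Z', hZ'⟩ := h s hs Z
        rw [← hZ]
        exact hZ'.trans (J'.form_le s hs Z')) (by rw [← J.trace_left, ← J'.trace_left, htr]) hk
    rw [if_pos h1, if_pos hk]
    exact_mod_cast h2
  · rw [if_neg hk]; exact le_top

/-- Joint convexity of the quantum relative entropy. -/
theorem relEntropy_convex {X₁ Y₁ X₂ Y₂ : Op S} (hX₁ : X₁.PosSemidef) (hY₁ : Y₁.PosSemidef)
    (hX₂ : X₂.PosSemidef) (hY₂ : Y₂.PosSemidef) {p q : ℝ} (hp : 0 < p) (hq : 0 < q) :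
    relEntropy ((p : ℂ) • X₁ + (q : ℂ) • X₂) ((p : ℂ) • Y₁ + (q : ℂ) • Y₂) ≤
      (p : EReal) * relEntropy X₁ Y₁ + (q : EReal) * relEntropy X₂ Y₂ := by
  have hp' : (0 : ℂ) ≤ p := Complex.zero_le_real.2 hp.le
  have hq' : (0 : ℂ) ≤ q := Complex.zero_le_real.2 hq.le
  obtain ⟨J⟩ := nonempty_jointSpectrum ((hX₁.smul hp').add (hX₂.smul hq'))
    ((hY₁.smul hp').add (hY₂.smul hq'))
  obtain ⟨J₁⟩ := nonempty_jointSpectrum hX₁ hY₁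
  obtain ⟨J₂⟩ := nonempty_jointSpectrum hX₂ hY₂
  -- In `EReal` one has `⊤ + ⊥ = ⊥`, so `⊥` must be excluded before an infinite term can make the
  -- bound trivial.
  have nb : ∀ {r : ℝ}, 0 < r → ∀ X Y : Op S, (r : EReal) * relEntropy X Y ≠ ⊥ := by
    intro r hr X Y
    unfold relEntropy
    split_ifs
    · rw [← EReal.coe_mul]; exact EReal.coe_ne_bot _
    · rw [EReal.coe_mul_top_of_pos hr]; exact top_ne_bot
  have b₁ := nb hp X₁ Y₁
  have b₂ := nb hq X₂ Y₂
  rw [J₁.relEntropy_eq] at b₁ ⊢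
  rw [J₂.relEntropy_eq] at b₂ ⊢
  by_cases k₁ : ∀ a, J₁.y a = 0 → J₁.w a * J₁.x a = 0
  swap
  · rw [if_neg k₁, EReal.coe_mul_top_of_pos hp, EReal.top_add_of_ne_bot b₂]; exact le_top
  by_cases k₂ : ∀ a, J₂.y a = 0 → J₂.w a * J₂.x a = 0
  swap
  · rw [if_neg k₂, EReal.coe_mul_top_of_pos hq, EReal.add_top_of_ne_bot b₁]; exact le_top
  rw [J.relEntropy_eq, if_pos k₁, if_pos k₂]
  -- The right-hand family is the disjoint union of both spectra, with only the weights rescaled by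
  -- `p` and `q`. A maximizer `Z` for the mixture is tested in both pairs, using linearity of the
  -- form.
  obtain ⟨h1, h2⟩ := sum_log_le_of_forall_sum_div_le (β := (S × S) ⊕ (S × S))
    (w' := Sum.elim (fun a => p * J₁.w a) (fun a => q * J₂.w a))
    (x' := Sum.elim J₁.x J₂.x) (y' := Sum.elim J₁.y J₂.y) J.w_nonneg J.x_nonneg J.y_nonneg
    (by rintro (a | a); exacts [J₁.x_nonneg a, J₂.x_nonneg a])
    (by rintro (a | a); exacts [J₁.y_nonneg a, J₂.y_nonneg a])
    (by rintro (a | a); exacts [mul_nonneg hp.le (J₁.w_nonneg a), mul_nonneg hq.le (J₂.w_nonneg a)])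
    (fun s hs => by
      obtain ⟨Z, hZ⟩ := J.exists_form_eq s hs
      simp only [Fintype.sum_sum_type, Sum.elim_inl, Sum.elim_inr, mul_assoc, ← Finset.mul_sum]
      have e : entropyForm s ((p : ℂ) • X₁ + (q : ℂ) • X₂) ((p : ℂ) • Y₁ + (q : ℂ) • Y₂) Z =
          p * entropyForm s X₁ Y₁ Z + q * entropyForm s X₂ Y₂ Z := by
        simp only [entropyForm, Matrix.mul_add, Matrix.add_mul, Matrix.mul_smul, Matrix.smul_mul,
          Matrix.trace_add, Matrix.trace_smul, Complex.add_re, smul_eq_mul, Complex.re_ofReal_mul]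
        ring
      rw [← hZ, e]
      exact add_le_add (mul_le_mul_of_nonneg_left (J₁.form_le s hs Z) hp.le)
        (mul_le_mul_of_nonneg_left (J₂.form_le s hs Z) hq.le))
    (by
      rw [← J.trace_left]
      simp only [Fintype.sum_sum_type, Sum.elim_inl, Sum.elim_inr, mul_assoc, ← Finset.mul_sum]
      rw [← J₁.trace_left, ← J₂.trace_left]
      simp [Matrix.trace_add, Matrix.trace_smul])
    (by
      rintro (a | a) ha
      · simp only [Sum.elim_inl] at ha ⊢; rw [mul_assoc, k₁ a ha, mul_zero]
      · simp only [Sum.elim_inr] at ha ⊢; rw [mul_assoc, k₂ a ha, mul_zero])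
  rw [if_pos h1]
  simp only [Fintype.sum_sum_type, Sum.elim_inl, Sum.elim_inr, mul_assoc p, mul_assoc q,
    ← Finset.mul_sum] at h2
  exact_mod_cast h2

/-- Klein's inequality with a quadratic remainder. -/
theorem trace_sub_add_le_relEntropy {X Y : Op S} (hX : X.PosSemidef) (hY : Y.PosSemidef)
    (hX1 : (1 - X).PosSemidef) (hY1 : (1 - Y).PosSemidef) :
    ((X.trace.re - Y.trace.re + ((X - Y) * (X - Y)).trace.re / 4 : ℝ) : EReal) ≤
      relEntropy X Y := by
  obtain ⟨J⟩ := nonempty_jointSpectrum hX hY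
  rw [J.relEntropy_eq]
  split_ifs with hk
  swap
  · exact le_top
  refine EReal.coe_le_coe_iff.2 ?_
  rw [J.trace_left, J.trace_right, J.trace_sq, ← Finset.sum_sub_distrib, Finset.sum_div,
    ← Finset.sum_add_distrib]
  refine Finset.sum_le_sum fun p _ => ?_
  rcases (J.w_nonneg p).eq_or_lt with h | h
  · rw [← h]; simp
  · have := sq_sub_div_four_le_mul_log_sub (J.x_nonneg p) (J.x_le_one hX1 p) (J.y_nonneg p)
      (J.y_le_one hY1 p) fun hy => (mul_eq_zero.1 (hk p hy)).resolve_left h.ne'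
    nlinarith [mul_le_mul_of_nonneg_left this h.le]

theorem trace_mul_re_nonneg {X Y : Op S} (hX : X.PosSemidef) (hY : Y.PosSemidef) :
    0 ≤ (X * Y).trace := by
  obtain ⟨U, x, -, -, hx, hXs, -⟩ := exists_ofSpectrum hX.1
  obtain ⟨V, y, -, -, hy, hYs, -⟩ := exists_ofSpectrum hY.1
  replace hx := hx hX
  replace hy := hy hY
  rw [hXs, hYs, trace_ofSpectrum_mul]
  exact Complex.zero_le_real.2 (Finset.sum_nonneg fun p _ =>
    mul_nonneg (Complex.normSq_nonneg _) (mul_nonneg (hx _) (hy _)))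

end RelEntropy

/-! ### Kadison-Schwarz inequality and data processing -/

section Schwarz

variable {S T : Type} [Fintype S] [DecidableEq S]

/-- The block matrix before applying `Φ` is a Gram matrix, hence positive; complete positivity is
used with a two-dimensional ancilla. -/
theorem IsCP.fromBlocks {Φ : Op S →ₗ[ℂ] Op T} (h : IsCP Φ) (Z : Op S) :
    (Matrix.fromBlocks (Φ (Z.conjTranspose * Z)) (Φ Z.conjTranspose) (Φ Z) (Φ 1)).PosSemidef := by
  have h1 : (Matrix.fromBlocks (Z.conjTranspose * Z) Z.conjTranspose Z 1).PosSemidef := by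
    have := Matrix.posSemidef_self_mul_conjTranspose (Matrix.fromRows Z.conjTranspose (1 : Op S))
    rw [Matrix.conjTranspose_fromRows_eq_fromCols_conjTranspose, Matrix.fromRows_mul_fromCols]
      at this
    simpa using this
  have h2 := h 2 _ (h1.submatrix fun p : S × Fin 2 => if p.2 = 0 then Sum.inl p.1 else Sum.inr p.1)
  have h3 := h2.submatrix (Sum.elim (fun i : T => (i, (0 : Fin 2))) fun i => (i, 1))
  convert h3 using 1
  ext (i | i) (j | j) <;> rfl

theorem IsCP.map_conjTranspose {Φ : Op S →ₗ[ℂ] Op T} (h : IsCP Φ) (Z : Op S) :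
    Φ Z.conjTranspose = (Φ Z).conjTranspose := by
  have := (h.fromBlocks Z).1
  rw [Matrix.isHermitian_fromBlocks_iff] at this
  rw [← this.2.2.1]

/-- The Kadison-Schwarz inequality. -/
theorem IsCP.schwarz [Fintype T] [DecidableEq T] {Φ : Op S →ₗ[ℂ] Op T} (h : IsCP Φ)
    (h1 : Φ 1 = 1) (Z : Op S) :
    (Φ (Z.conjTranspose * Z) - (Φ Z).conjTranspose * Φ Z).PosSemidef := by
  have h2 := h.fromBlocks Z
  have : Φ Z = (Φ Z.conjTranspose).conjTranspose := by rw [h.map_conjTranspose]; simp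
  rw [h1, this] at h2
  have : Invertible (1 : Op T) := invertibleOne
  -- Schur complement of the lower right block, which is the identity since `Φ` is unital.
  have h3 := (Matrix.PosDef.fromBlocks₂₂ _ _ Matrix.PosDef.one).1 h2
  simp only [inv_one, Matrix.mul_one] at h3
  rw [h.map_conjTranspose Z] at h3
  simpa using h3

variable [Fintype T] [DecidableEq T]

theorem IsCP.map_posSemidef {A A' : Type} {Φ : Op A →ₗ[ℂ] Op A'} (h : IsCP Φ)
    {X : Op A} (hX : X.PosSemidef) : (Φ X).PosSemidef :=
  (h 1 _ (hX.submatrix Prod.fst)).submatrix fun i => (i, 0)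

/-- Testing against `v v†` moves `Φ` onto a positive rank-one operator, and the trace of a product
of positive operators is nonnegative. -/
theorem IsCP.dualMap_posSemidef {Φ : Op S →ₗ[ℂ] Op T} (h : IsCP Φ) {Y : Op T}
    (hY : Y.PosSemidef) : (dualMap Φ Y).PosSemidef := by
  refine Matrix.PosSemidef.of_dotProduct_mulVec_nonneg ?_ fun v => ?_
  · ext i j
    rw [Matrix.conjTranspose_apply]
    simp only [dualMap, Matrix.of_apply]
    rw [← Matrix.trace_conjTranspose, Matrix.conjTranspose_mul, ← h.map_conjTranspose,
      hY.1.eq, Matrix.trace_mul_comm, Matrix.conjTranspose_single, star_one]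
  · have h2 := trace_mul_re_nonneg hY (h.map_posSemidef (Matrix.posSemidef_vecMulVec_self_star v))
    rw [← trace_dualMap_mul] at h2
    convert h2 using 1
    rw [Matrix.mul_vecMulVec, Matrix.trace_vecMulVec, dotProduct_comm]

/-- Data processing: the dual of a unital completely positive map does not increase the relative
entropy. -/
theorem relEntropy_dualMap_le {Φ : Op S →ₗ[ℂ] Op T} (h : IsCP Φ) (h1 : Φ 1 = 1) {X Y : Op T}
    (hX : X.PosSemidef) (hY : Y.PosSemidef) :
    relEntropy (dualMap Φ X) (dualMap Φ Y) ≤ relEntropy X Y := by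
  -- With `Φ Z` as the competitor, the linear terms agree by duality; the two subtracted quadratic
  -- terms can only shrink, by the Schwarz inequality for `Z` and for its adjoint.
  refine relEntropy_le_of_forall_entropyForm_le (h.dualMap_posSemidef hX) (h.dualMap_posSemidef hY)
    hX hY ?_ fun s hs Z => ⟨Φ Z, ?_⟩
  · have := trace_dualMap_mul Φ X 1
    rwa [h1, Matrix.mul_one, Matrix.mul_one] at this
  · have e1 : (Z.conjTranspose * dualMap Φ X).trace = ((Φ Z).conjTranspose * X).trace := by
      rw [Matrix.trace_mul_comm, trace_dualMap_mul, h.map_conjTranspose, Matrix.trace_mul_comm]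
    have e2 : (Φ Z * X * (Φ Z).conjTranspose).trace.re ≤
        (Z * dualMap Φ X * Z.conjTranspose).trace.re := by
      have := (Complex.le_def.1 (trace_mul_re_nonneg hX (h.schwarz h1 Z))).1
      rw [Matrix.mul_sub, Matrix.trace_sub, ← trace_dualMap_mul, Complex.zero_re,
        Complex.sub_re, sub_nonneg, ← Matrix.mul_assoc, ← Matrix.mul_assoc,
        Matrix.trace_mul_cycle, Matrix.trace_mul_cycle (dualMap Φ X)] at this
      exact this
    have e3 : ((Φ Z).conjTranspose * Y * Φ Z).trace.re ≤
        (Z.conjTranspose * dualMap Φ Y * Z).trace.re := by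
      have := (Complex.le_def.1 (trace_mul_re_nonneg hY (h.schwarz h1 Z.conjTranspose))).1
      rw [Matrix.mul_sub, Matrix.trace_sub, ← trace_dualMap_mul, Complex.zero_re,
        Complex.sub_re, sub_nonneg, ← Matrix.mul_assoc, ← Matrix.mul_assoc,
        Matrix.trace_mul_cycle, Matrix.trace_mul_cycle (dualMap Φ Y),
        h.map_conjTranspose] at this
      simpa using this
    rw [entropyForm, entropyForm, e1]
    have := mul_le_mul_of_nonneg_left e2 hs.le
    linarith

end Schwarz

/-! ### Tensor products, complete positivity and ancillas -/

section TensorMap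

variable {A A' A'' B B' B'' C D : Type}

theorem single_eq_smul_kronecker [DecidableEq A] [DecidableEq B] (p q : A × B) (c : ℂ) :
    (Matrix.single p q c : Op (A × B)) =
      c • Matrix.kronecker (Matrix.single p.1 q.1 1) (Matrix.single p.2 q.2 1) := by
  have h := Matrix.single_kronecker_single p.1 q.1 p.2 q.2 (1 : ℂ) 1
  refine Eq.trans ?_ (congrArg (c • ·) h).symm
  simp [Matrix.smul_single]

/-- Linear maps on bipartite operators that agree on product operators are equal. -/
theorem ext_kronecker {M : Type*} [AddCommMonoid M] [Module ℂ M] [Fintype A] [Fintype B]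
    {F G : Op (A × B) →ₗ[ℂ] M}
    (h : ∀ X Y, F (Matrix.kronecker X Y) = G (Matrix.kronecker X Y)) : F = G := by
  classical
  refine LinearMap.ext fun X => ?_
  rw [Matrix.matrix_eq_sum_single X]
  simp only [map_sum]
  refine Finset.sum_congr rfl fun p _ => Finset.sum_congr rfl fun q _ => ?_
  rw [single_eq_smul_kronecker, map_smul, map_smul, h]

theorem tensorMap_comp (Φ' : Op A' →ₗ[ℂ] Op A'') (Ψ' : Op B' →ₗ[ℂ] Op B'')
    (Φ : Op A →ₗ[ℂ] Op A') (Ψ : Op B →ₗ[ℂ] Op B') [Fintype A] [Fintype B] :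
    tensorMap Φ' Ψ' ∘ₗ tensorMap Φ Ψ = tensorMap (Φ' ∘ₗ Φ) (Ψ' ∘ₗ Ψ) :=
  ext_kronecker fun X Y => by simp only [LinearMap.comp_apply, tensorMap_kronecker]

theorem trace_tensorMap [Fintype A] [Fintype B] [Fintype A'] [Fintype B']
    {Φ : Op A →ₗ[ℂ] Op A'} {Ψ : Op B →ₗ[ℂ] Op B'} (hΨ : ∀ X, (Ψ X).trace = X.trace)
    (X : Op A) (Y : Op B) :
    (tensorMap Φ Ψ (Matrix.kronecker X Y)).trace = (Φ X).trace * Y.trace := by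
  rw [tensorMap_kronecker]
  exact (Matrix.trace_kronecker _ _).trans (by rw [hΨ])

/-- The completely positive map `X ↦ V X V†`. -/
def conjMap [Fintype A] (V : Matrix A' A ℂ) : Op A →ₗ[ℂ] Op A' where
  toFun X := V * X * V.conjTranspose
  map_add' X Y := by rw [Matrix.mul_add, Matrix.add_mul]
  map_smul' r X := by simp

theorem IsCP.comp {Φ' : Op A' →ₗ[ℂ] Op A''} {Φ : Op A →ₗ[ℂ] Op A'} (h' : IsCP Φ') (h : IsCP Φ) :
    IsCP (Φ' ∘ₗ Φ) :=
  fun k X hX => h' k _ (h k X hX)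

theorem IsCP.zero : IsCP (0 : Op A →ₗ[ℂ] Op A') :=
  fun _ _ _ => Matrix.PosSemidef.zero

theorem IsCP.id : IsCP (LinearMap.id : Op A →ₗ[ℂ] Op A) :=
  fun _ _ hX => hX

theorem IsCP.add {Φ Φ' : Op A →ₗ[ℂ] Op A'} (h : IsCP Φ) (h' : IsCP Φ') : IsCP (Φ + Φ') :=
  fun k X hX => (h k X hX).add (h' k X hX)

theorem IsCP.sum {ι : Type*} (s : Finset ι) {Φ : ι → (Op A →ₗ[ℂ] Op A')}
    (h : ∀ i ∈ s, IsCP (Φ i)) : IsCP (∑ i ∈ s, Φ i) :=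
  Finset.sum_induction _ IsCP (fun _ _ => IsCP.add) IsCP.zero h

theorem IsCP.smul {Φ : Op A →ₗ[ℂ] Op A'} (h : IsCP Φ) {c : ℂ} (hc : 0 ≤ c) : IsCP (c • Φ) :=
  fun k X hX => (h k X hX).smul hc

theorem isCP_conjMap [Fintype A] [Fintype A'] (V : Matrix A' A ℂ) : IsCP (conjMap V) := by
  intro k X hX
  have h : tensorMap (conjMap V) (LinearMap.id : Op (Fin k) →ₗ[ℂ] Op (Fin k)) =
      conjMap (Matrix.kronecker V (1 : Op (Fin k))) := by
    refine ext_kronecker fun X Y => ?_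
    rw [tensorMap_kronecker]
    change Matrix.kronecker (V * X * V.conjTranspose) Y = (Matrix.kronecker V (1 : Op (Fin k)) :
      Matrix (A' × Fin k) (A × Fin k) ℂ) * (Matrix.kronecker X Y : Op (A × Fin k)) *
      (Matrix.kronecker V (1 : Op (Fin k)) : Matrix (A' × Fin k) (A × Fin k) ℂ).conjTranspose
    unfold Matrix.kronecker
    rw [Matrix.conjTranspose_kronecker, ← Matrix.mul_kronecker_mul,
      ← Matrix.mul_kronecker_mul, Matrix.one_mul, Matrix.conjTranspose_one, Matrix.mul_one]
  rw [h]
  exact hX.mul_mul_conjTranspose_same _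

theorem IsCP.tensorMap_id_posSemidef {Φ : Op A →ₗ[ℂ] Op A'} (h : IsCP Φ) (R : Type) [Fintype R]
    {X : Op (A × R)} (hX : X.PosSemidef) :
    (tensorMap Φ (LinearMap.id : Op R →ₗ[ℂ] Op R) X).PosSemidef := by
  have e := Fintype.equivFin R
  have h1 := (h _ _ (hX.submatrix fun p : A × Fin (Fintype.card R) => (p.1, e.symm p.2))).submatrix
    fun p : A' × R => (p.1, e p.2)
  convert h1 using 1
  ext p q
  simp [tensorMap]

/-- The two maps act one after the other, each treating all remaining factors as its ancilla. -/
theorem IsCP.tensorMap {Φ : Op A →ₗ[ℂ] Op A'} {Ψ : Op B →ₗ[ℂ] Op B'} [Fintype A] [Fintype B']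
    (h : IsCP Φ) (h' : IsCP Ψ) : IsCP (tensorMap Φ Ψ) := by
  intro k X hX
  have h1 := (h'.tensorMap_id_posSemidef (A × Fin k)
    (hX.submatrix fun p : B × A × Fin k => ((p.2.1, p.1), p.2.2))).submatrix
    fun p : A × B' × Fin k => (p.2.1, p.1, p.2.2)
  exact (h.tensorMap_id_posSemidef (B' × Fin k) h1).submatrix
    fun p : (A' × B') × Fin k => (p.1.1, p.1.2, p.2)

/-- The extension of a map `AB → A'B'` by ancillas `C` and `D`. -/
def ancillaMap (C D : Type) (Φ : Op (A × B) →ₗ[ℂ] Op (A' × B')) :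
    Op ((A × C) × (B × D)) →ₗ[ℂ] Op ((A' × C) × (B' × D)) :=
  (Matrix.reindexLinearEquiv ℂ ℂ (Equiv.prodProdProdComm A' B' C D)
    (Equiv.prodProdProdComm A' B' C D)).toLinearMap ∘ₗ
    QuantumResource.tensorMap Φ (LinearMap.id : Op (C × D) →ₗ[ℂ] Op (C × D)) ∘ₗ
    (Matrix.reindexLinearEquiv ℂ ℂ (Equiv.prodProdProdComm A B C D)
      (Equiv.prodProdProdComm A B C D)).symm.toLinearMap

theorem ancillaMap_apply (C D : Type) (Φ : Op (A × B) →ₗ[ℂ] Op (A' × B'))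
    (X : Op ((A × C) × (B × D))) (p q : (A' × C) × (B' × D)) :
    ancillaMap C D Φ X p q = Φ (Matrix.of fun a b => X ((a.1, p.1.2), (a.2, p.2.2))
      ((b.1, q.1.2), (b.2, q.2.2))) (p.1.1, p.2.1) (q.1.1, q.2.1) := rfl

theorem ancillaMap_comp (C D : Type) (Φ : Op (A × B) →ₗ[ℂ] Op (A' × B'))
    (Φ' : Op (A' × B') →ₗ[ℂ] Op (A'' × B'')) :
    ancillaMap C D (Φ' ∘ₗ Φ) = ancillaMap C D Φ' ∘ₗ ancillaMap C D Φ := rfl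

theorem ancillaMap_add (C D : Type) (Φ Φ' : Op (A × B) →ₗ[ℂ] Op (A' × B')) :
    ancillaMap C D (Φ + Φ') = ancillaMap C D Φ + ancillaMap C D Φ' := rfl

theorem ancillaMap_smul (C D : Type) (c : ℂ) (Φ : Op (A × B) →ₗ[ℂ] Op (A' × B')) :
    ancillaMap C D (c • Φ) = c • ancillaMap C D Φ := rfl

theorem ancillaMap_sum (C D : Type) {ι : Type*} (s : Finset ι)
    (Φ : ι → (Op (A × B) →ₗ[ℂ] Op (A' × B'))) :
    ancillaMap C D (∑ i ∈ s, Φ i) = ∑ i ∈ s, ancillaMap C D (Φ i) := by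
  let f : (Op (A × B) →ₗ[ℂ] Op (A' × B')) →+
      (Op ((A × C) × (B × D)) →ₗ[ℂ] Op ((A' × C) × (B' × D))) :=
    { toFun := ancillaMap C D, map_zero' := rfl, map_add' := ancillaMap_add C D }
  exact map_sum f Φ s

theorem IsCP.ancillaMap [Fintype C] [Fintype D] {Φ : Op (A × B) →ₗ[ℂ] Op (A' × B')}
    (h : IsCP Φ) : IsCP (ancillaMap C D Φ) := by
  intro k X hX
  exact (h.tensorMap_id_posSemidef ((C × D) × Fin k) (hX.submatrix
    fun p : (A × B) × (C × D) × Fin k =>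
      (((p.1.1, p.2.1.1), (p.1.2, p.2.1.2)), p.2.2))).submatrix
    fun p : ((A' × C) × (B' × D)) × Fin k =>
      ((p.1.1.1, p.1.2.1), (p.1.1.2, p.1.2.2), p.2)

end TensorMap

/-! ### LOCC channels: trace preservation, ancillas, composition -/

section LOCC

variable {A A' A'' B B' B'' C D : Type} [Fintype A] [Fintype A'] [Fintype A''] [Fintype B]
  [Fintype B'] [Fintype B''] [Fintype C] [Fintype D]

theorem IsChannel.id : IsChannel (LinearMap.id : Op A →ₗ[ℂ] Op A) := ⟨IsCP.id, fun _ => rfl⟩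

theorem IsChannel.comp {Φ' : Op A' →ₗ[ℂ] Op A''} {Φ : Op A →ₗ[ℂ] Op A'} (h' : IsChannel Φ')
    (h : IsChannel Φ) : IsChannel (Φ' ∘ₗ Φ) :=
  ⟨h'.1.comp h.1, fun X => (h'.2 _).trans (h.2 X)⟩

theorem isChannel_sum_tensorMap {ι : Type*} (s : Finset ι) {Φ : ι → (Op A →ₗ[ℂ] Op A')}
    {Ψ : ι → (Op B →ₗ[ℂ] Op B')} (hΦ : ∀ a, IsCP (Φ a)) (hΦs : IsChannel (∑ a ∈ s, Φ a))
    (hΨ : ∀ a, IsChannel (Ψ a)) : IsChannel (∑ a ∈ s, tensorMap (Φ a) (Ψ a)) := by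
  refine ⟨IsCP.sum _ fun a _ => (hΦ a).tensorMap (hΨ a).1, fun X => ?_⟩
  refine LinearMap.congr_fun (f := Matrix.traceLinearMap _ ℂ ℂ ∘ₗ ∑ a ∈ s, tensorMap (Φ a) (Ψ a))
    (g := Matrix.traceLinearMap _ ℂ ℂ) (ext_kronecker fun X Y => ?_) X
  simp only [LinearMap.comp_apply, LinearMap.sum_apply, Matrix.traceLinearMap_apply,
    Matrix.trace_sum, trace_tensorMap (hΨ _).2, ← Finset.sum_mul]
  rw [← Matrix.trace_sum, ← LinearMap.sum_apply, hΦs.2]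
  exact (Matrix.trace_kronecker _ _).symm

theorem isChannel_sum_tensorMap' {ι : Type*} (s : Finset ι) {Φ : ι → (Op A →ₗ[ℂ] Op A')}
    {Ψ : ι → (Op B →ₗ[ℂ] Op B')} (hΦ : ∀ a, IsChannel (Φ a)) (hΨ : ∀ a, IsCP (Ψ a))
    (hΨs : IsChannel (∑ a ∈ s, Ψ a)) : IsChannel (∑ a ∈ s, tensorMap (Φ a) (Ψ a)) := by
  refine ⟨IsCP.sum _ fun a _ => (hΦ a).1.tensorMap (hΨ a), fun X => ?_⟩
  refine LinearMap.congr_fun (f := Matrix.traceLinearMap _ ℂ ℂ ∘ₗ ∑ a ∈ s, tensorMap (Φ a) (Ψ a))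
    (g := Matrix.traceLinearMap _ ℂ ℂ) (ext_kronecker fun X Y => ?_) X
  have h : ∀ a, (tensorMap (Φ a) (Ψ a) (Matrix.kronecker X Y)).trace =
      X.trace * (Ψ a Y).trace := fun a => by
    rw [tensorMap_kronecker]
    exact (Matrix.trace_kronecker _ _).trans (by rw [(hΦ a).2])
  simp only [LinearMap.comp_apply, LinearMap.sum_apply, Matrix.traceLinearMap_apply,
    Matrix.trace_sum, h, ← Finset.mul_sum]
  rw [← Matrix.trace_sum, ← LinearMap.sum_apply, hΨs.2]
  exact (Matrix.trace_kronecker _ _).symm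

theorem IsChannel.tensorMap {Φ : Op A →ₗ[ℂ] Op A'} {Ψ : Op B →ₗ[ℂ] Op B'} (h : IsChannel Φ)
    (h' : IsChannel Ψ) : IsChannel (tensorMap Φ Ψ) := by
  simpa using isChannel_sum_tensorMap (Finset.univ : Finset Unit) (fun _ => h.1)
    (by simpa using h) (fun _ => h')

/-- One-way LOCC channels in either direction. -/
def IsOneWay (Ξ : Op (A × B) →ₗ[ℂ] Op (A' × B')) : Prop := IsOneWayRight Ξ ∨ IsOneWayLeft Ξ

theorem IsOneWay.isChannel {Ξ : Op (A × B) →ₗ[ℂ] Op (A' × B')} (h : IsOneWay Ξ) :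
    IsChannel Ξ := by
  rcases h with ⟨m, Φ, Ψ, h1, h2, h3, rfl⟩ | ⟨m, Φ, Ψ, h1, h2, h3, rfl⟩
  · exact isChannel_sum_tensorMap _ h1 h2 h3
  · exact isChannel_sum_tensorMap' _ h1 h2 h3

/-- Each party lets its local maps act trivially on its own ancilla; the communication pattern is
unchanged. -/
theorem IsOneWay.ancillaMap {Ξ : Op (A × B) →ₗ[ℂ] Op (A' × B')} (h : IsOneWay Ξ) :
    IsOneWay (ancillaMap C D Ξ) := by
  have key : ∀ {E E' R : Type} [Fintype E] [Fintype E'] [Fintype R] {m : ℕ}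
      {Φ : Fin m → (Op E →ₗ[ℂ] Op E')}, (∀ a, IsCP (Φ a)) → IsChannel (∑ a, Φ a) →
      IsChannel (∑ a, QuantumResource.tensorMap (Φ a) (LinearMap.id : Op R →ₗ[ℂ] Op R)) :=
    fun h1 h2 => isChannel_sum_tensorMap _ h1 h2 fun _ => IsChannel.id
  rcases h with ⟨m, Φ, Ψ, h1, h2, h3, rfl⟩ | ⟨m, Φ, Ψ, h1, h2, h3, rfl⟩
  · exact Or.inl ⟨m, fun a => QuantumResource.tensorMap (Φ a) LinearMap.id,
      fun a => QuantumResource.tensorMap (Ψ a) LinearMap.id, fun a => (h1 a).tensorMap IsCP.id,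
      key h1 h2, fun a => (h3 a).tensorMap IsChannel.id, ancillaMap_sum _ _ _ _⟩
  · exact Or.inr ⟨m, fun a => QuantumResource.tensorMap (Φ a) LinearMap.id,
      fun a => QuantumResource.tensorMap (Ψ a) LinearMap.id, fun a => (h1 a).tensorMap IsChannel.id,
      fun a => (h2 a).tensorMap IsCP.id, key h2 h3, ancillaMap_sum _ _ _ _⟩

theorem isOneWay_tensorMap {Φ : Op A →ₗ[ℂ] Op A'} {Ψ : Op B →ₗ[ℂ] Op B'} (h : IsChannel Φ)
    (h' : IsChannel Ψ) : IsOneWay (tensorMap Φ Ψ) :=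
  Or.inl ⟨1, fun _ => Φ, fun _ => Ψ, fun _ => h.1, by simpa using h, fun _ => h', by simp⟩

theorem IsLOCC.isChannel {Ξ : Op (A × B) →ₗ[ℂ] Op (A' × B')} (h : IsLOCC Ξ) : IsChannel Ξ := by
  induction h with
  | oneWay h => exact IsOneWay.isChannel h
  | comp h h' ih => exact (IsOneWay.isChannel h').comp ih

theorem IsLOCC.ancillaMap {Ξ : Op (A × B) →ₗ[ℂ] Op (A' × B')} (h : IsLOCC Ξ) :
    IsLOCC (ancillaMap C D Ξ) := by
  induction h with
  | oneWay h => exact .oneWay (IsOneWay.ancillaMap h)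
  | comp h h' ih =>
    rw [ancillaMap_comp]
    exact .comp ih (IsOneWay.ancillaMap h')

theorem IsLOCC.trans {Ξ : Op (A × B) →ₗ[ℂ] Op (A' × B')} {Θ : Op (A' × B') →ₗ[ℂ] Op (A'' × B'')}
    (h : IsLOCC Ξ) (h' : IsLOCC Θ) : IsLOCC (Θ ∘ₗ Ξ) := by
  induction h' with
  | oneWay h' => exact .comp h h'
  | comp _ h' ih =>
    rw [LinearMap.comp_assoc]
    exact .comp ih h'

end LOCC

/-! ### Direct sums of systems and shared randomness -/

section BlockMaps

variable {A A' B B' C D : Type}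

/-- The embedding of operators on `A` as the first diagonal block of operators on `A ⊕ C`. -/
def inlMap (A C : Type) : Op A →ₗ[ℂ] Op (A ⊕ C) where
  toFun X := Matrix.fromBlocks X 0 0 0
  map_add' X Y := by rw [Matrix.fromBlocks_add]; simp
  map_smul' r X := by rw [RingHom.id_apply, Matrix.fromBlocks_smul]; simp

/-- The embedding of operators on `C` as the second diagonal block of operators on `A ⊕ C`. -/
def inrMap (A C : Type) : Op C →ₗ[ℂ] Op (A ⊕ C) where
  toFun X := Matrix.fromBlocks 0 0 0 X
  map_add' X Y := by rw [Matrix.fromBlocks_add]; simp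
  map_smul' r X := by rw [RingHom.id_apply, Matrix.fromBlocks_smul]; simp

/-- The first diagonal block of operators on `A ⊕ C`. -/
def fstMap (A C : Type) : Op (A ⊕ C) →ₗ[ℂ] Op A where
  toFun X := X.toBlocks₁₁
  map_add' _ _ := rfl
  map_smul' _ _ := rfl

/-- The second diagonal block of operators on `A ⊕ C`. -/
def sndMap (A C : Type) : Op (A ⊕ C) →ₗ[ℂ] Op C where
  toFun X := X.toBlocks₂₂
  map_add' _ _ := rfl
  map_smul' _ _ := rfl

@[simp] theorem fstMap_comp_inlMap : fstMap A C ∘ₗ inlMap A C = LinearMap.id := rfl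

@[simp] theorem fstMap_comp_inrMap : fstMap A C ∘ₗ inrMap A C = 0 := rfl

@[simp] theorem sndMap_comp_inrMap : sndMap A C ∘ₗ inrMap A C = LinearMap.id := rfl

@[simp] theorem sndMap_comp_inlMap : sndMap A C ∘ₗ inlMap A C = 0 := rfl

theorem isCP_fstMap : IsCP (fstMap A C) :=
  fun k _ hX => hX.submatrix fun p : A × Fin k => (Sum.inl p.1, p.2)

theorem isCP_sndMap : IsCP (sndMap A C) :=
  fun k _ hX => hX.submatrix fun p : C × Fin k => (Sum.inr p.1, p.2)

/-- The map `Φ` on the first block, completed by the identity on the second block if `c`. -/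
def blockExtend (C : Type) (c : Prop) [Decidable c] (Φ : Op A →ₗ[ℂ] Op A') :
    Op (A ⊕ C) →ₗ[ℂ] Op (A' ⊕ C) :=
  inlMap A' C ∘ₗ Φ ∘ₗ fstMap A C + if c then inrMap A' C ∘ₗ sndMap A C else 0

theorem blockExtend_comp_inlMap (c : Prop) [Decidable c] (Φ : Op A →ₗ[ℂ] Op A') :
    blockExtend C c Φ ∘ₗ inlMap A C = inlMap A' C ∘ₗ Φ := by
  unfold blockExtend
  split_ifs <;> simp [LinearMap.add_comp, LinearMap.comp_assoc]

theorem blockExtend_comp_inrMap (c : Prop) [Decidable c] (Φ : Op A →ₗ[ℂ] Op A') :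
    blockExtend C c Φ ∘ₗ inrMap A C = if c then inrMap A' C else 0 := by
  unfold blockExtend
  split_ifs <;> simp [LinearMap.add_comp, LinearMap.comp_assoc]

/-- Only branch `i` of the instrument keeps the second block, so the total is the identity there and
not `m` copies of it. -/
theorem sum_blockExtend {m : ℕ} (i : Fin m) (Φ : Fin m → (Op A →ₗ[ℂ] Op A')) :
    ∑ a, blockExtend C (a = i) (Φ a) = blockExtend C True (∑ a, Φ a) := by
  simp only [blockExtend, Finset.sum_add_distrib, Finset.sum_ite_eq', Finset.mem_univ, if_true]
  congr 1
  refine LinearMap.ext fun X => ?_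
  simp [LinearMap.sum_apply]

variable [Fintype A'] [Fintype C]

theorem isChannel_inlMap : IsChannel (inlMap A' C) := by
  classical
  constructor
  · have h : inlMap A' C = conjMap (Matrix.fromRows (1 : Matrix A' A' ℂ) (0 : Matrix C A' ℂ)) := by
      refine LinearMap.ext fun X => ?_
      simp only [inlMap, conjMap, Matrix.conjTranspose_fromRows_eq_fromCols_conjTranspose,
        Matrix.fromRows_mul, Matrix.mul_fromCols, LinearMap.coe_mk, AddHom.coe_mk]
      ext (i | i) (j | j) <;> simp
    rw [h]; exact isCP_conjMap _
  · intro X; simp [inlMap, Matrix.trace]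

theorem isChannel_inrMap : IsChannel (inrMap A' C) := by
  classical
  constructor
  · have h : inrMap A' C = conjMap (Matrix.fromRows (0 : Matrix A' C ℂ) (1 : Matrix C C ℂ)) := by
      refine LinearMap.ext fun X => ?_
      simp only [inrMap, conjMap, Matrix.conjTranspose_fromRows_eq_fromCols_conjTranspose,
        Matrix.fromRows_mul, Matrix.mul_fromCols, LinearMap.coe_mk, AddHom.coe_mk]
      ext (i | i) (j | j) <;> simp
    rw [h]; exact isCP_conjMap _
  · intro X; simp [inrMap, Matrix.trace]

theorem IsCP.blockExtend (c : Prop) [Decidable c] {Φ : Op A →ₗ[ℂ] Op A'} (h : IsCP Φ) :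
    IsCP (blockExtend C c Φ) := by
  refine (isChannel_inlMap.1.comp (h.comp isCP_fstMap)).add ?_
  split_ifs
  · exact isChannel_inrMap.1.comp isCP_sndMap
  · exact IsCP.zero

variable [Fintype A] [Fintype B] [Fintype B'] [Fintype D]

theorem trace_fstMap_add_trace_sndMap (X : Op (A ⊕ C)) :
    (fstMap A C X).trace + (sndMap A C X).trace = X.trace := by
  simp [fstMap, sndMap, Matrix.trace, Matrix.toBlocks₁₁, Matrix.toBlocks₂₂]

/-- Channels applied to the two diagonal blocks give a channel. -/
theorem isChannel_blocks {T : Type} [Fintype T] {Φ : Op A →ₗ[ℂ] Op T} {Ψ : Op C →ₗ[ℂ] Op T}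
    (h : IsChannel Φ) (h' : IsChannel Ψ) : IsChannel (Φ ∘ₗ fstMap A C + Ψ ∘ₗ sndMap A C) := by
  refine ⟨(h.1.comp isCP_fstMap).add (h'.1.comp isCP_sndMap), fun X => ?_⟩
  simp [h.2, h'.2, trace_fstMap_add_trace_sndMap]

theorem IsChannel.nonempty [Nonempty A] {Φ : Op A →ₗ[ℂ] Op A'} (h : IsChannel Φ) :
    Nonempty A' := by
  classical
  by_contra h'
  rw [not_nonempty_iff] at h'
  have h1 := h.2 1
  simp [Matrix.trace] at h1
  exact Fintype.card_ne_zero (α := A) (by exact_mod_cast h1.symm)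

/-- An empty sum is zero and cannot preserve the positive trace of the identity. The index obtained
serves as the outcome announced on the second block. -/
theorem instrument_index_nonempty [Nonempty A] {m : ℕ} {Φ : Fin m → (Op A →ₗ[ℂ] Op A')}
    (h : IsChannel (∑ a, Φ a)) : Nonempty (Fin m) := by
  classical
  by_contra h'
  rw [not_nonempty_iff] at h'
  have h1 := h.2 1
  simp [Matrix.trace] at h1
  exact Fintype.card_ne_zero (α := A) (by exact_mod_cast h1.symm)

theorem IsChannel.blockExtend {c : Prop} [Decidable c] (hc : c) {Φ : Op A →ₗ[ℂ] Op A'}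
    (h : IsChannel Φ) : IsChannel (blockExtend C c Φ) := by
  unfold QuantumResource.blockExtend
  rw [if_pos hc, ← LinearMap.comp_assoc]
  exact isChannel_blocks (isChannel_inlMap.comp h) isChannel_inrMap

/-- On the second blocks the instrument always returns the fixed outcome `i`, and the receiver's
channels all act as the identity there. -/
theorem IsOneWay.exists_block [Nonempty A] [Nonempty B] {Ξ : Op (A × B) →ₗ[ℂ] Op (A' × B')}
    (h : IsOneWay Ξ) : ∃ Λ : Op ((A ⊕ C) × (B ⊕ D)) →ₗ[ℂ] Op ((A' ⊕ C) × (B' ⊕ D)), IsOneWay Λ ∧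
      Λ ∘ₗ tensorMap (inlMap A C) (inlMap B D) = tensorMap (inlMap A' C) (inlMap B' D) ∘ₗ Ξ ∧
      Λ ∘ₗ tensorMap (inrMap A C) (inrMap B D) = tensorMap (inrMap A' C) (inrMap B' D) := by
  rcases h with ⟨m, Φ, Ψ, h1, h2, h3, rfl⟩ | ⟨m, Φ, Ψ, h1, h2, h3, rfl⟩
  · obtain ⟨i⟩ := instrument_index_nonempty h2
    refine ⟨∑ a, tensorMap (blockExtend C (a = i) (Φ a)) (blockExtend D True (Ψ a)),
      Or.inl ⟨m, _, _, fun a => (h1 a).blockExtend _, ?_, fun a => (h3 a).blockExtend trivial, rfl⟩,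
      ?_, ?_⟩
    · rw [sum_blockExtend]; exact h2.blockExtend trivial
    · refine LinearMap.ext fun X => ?_
      simp only [LinearMap.comp_apply, LinearMap.sum_apply, map_sum]
      refine Finset.sum_congr rfl fun a _ => ?_
      simp only [← LinearMap.comp_apply, tensorMap_comp, blockExtend_comp_inlMap]
    · refine LinearMap.ext fun X => ?_
      simp only [LinearMap.comp_apply, LinearMap.sum_apply]
      rw [Finset.sum_eq_single i]
      · simp only [← LinearMap.comp_apply, tensorMap_comp, blockExtend_comp_inrMap, if_true]
      · intro a _ ha
        simp only [← LinearMap.comp_apply, tensorMap_comp, blockExtend_comp_inrMap, if_neg ha]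
        rfl
      · simp
  · obtain ⟨i⟩ := instrument_index_nonempty h3
    refine ⟨∑ a, tensorMap (blockExtend C True (Φ a)) (blockExtend D (a = i) (Ψ a)),
      Or.inr ⟨m, _, _, fun a => (h1 a).blockExtend trivial, fun a => (h2 a).blockExtend _, ?_, rfl⟩,
      ?_, ?_⟩
    · rw [sum_blockExtend]; exact h3.blockExtend trivial
    · refine LinearMap.ext fun X => ?_
      simp only [LinearMap.comp_apply, LinearMap.sum_apply, map_sum]
      refine Finset.sum_congr rfl fun a _ => ?_
      simp only [← LinearMap.comp_apply, tensorMap_comp, blockExtend_comp_inlMap]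
    · refine LinearMap.ext fun X => ?_
      simp only [LinearMap.comp_apply, LinearMap.sum_apply]
      rw [Finset.sum_eq_single i]
      · simp only [← LinearMap.comp_apply, tensorMap_comp, blockExtend_comp_inrMap, if_true]
      · intro a _ ha
        simp only [← LinearMap.comp_apply, tensorMap_comp, blockExtend_comp_inrMap, if_neg ha]
        ext p q
        exact congrFun (congrFun (map_zero (inrMap A' C)) _) _
      · simp

/-- Every LOCC channel extends to an LOCC channel acting as the identity on a second pair of
blocks. -/
theorem IsLOCC.exists_block [Nonempty A] [Nonempty B] {Ξ : Op (A × B) →ₗ[ℂ] Op (A' × B')}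
    (h : IsLOCC Ξ) : ∃ Λ : Op ((A ⊕ C) × (B ⊕ D)) →ₗ[ℂ] Op ((A' ⊕ C) × (B' ⊕ D)), IsLOCC Λ ∧
      Λ ∘ₗ tensorMap (inlMap A C) (inlMap B D) = tensorMap (inlMap A' C) (inlMap B' D) ∘ₗ Ξ ∧
      Λ ∘ₗ tensorMap (inrMap A C) (inrMap B D) = tensorMap (inrMap A' C) (inrMap B' D) := by
  induction h with
  | oneWay h =>
    obtain ⟨Λ, h1, h2⟩ := IsOneWay.exists_block (C := C) (D := D) h
    exact ⟨Λ, .oneWay h1, h2⟩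
  | comp h h' ih =>
    obtain ⟨Λ, h1, h2, h3⟩ := ih
    have hn := h.isChannel.nonempty
    rw [nonempty_prod] at hn
    obtain ⟨hn1, hn2⟩ := hn
    obtain ⟨Λ', h1', h2', h3'⟩ := IsOneWay.exists_block (C := C) (D := D) h'
    refine ⟨Λ' ∘ₗ Λ, .comp h1 h1', ?_, ?_⟩
    · rw [LinearMap.comp_assoc, h2, ← LinearMap.comp_assoc, h2', LinearMap.comp_assoc]
    · rw [LinearMap.comp_assoc, h3, h3']

/-- Shared randomness: LOCC channels form a convex set. -/
theorem IsLOCC.convex [Nonempty A] [Nonempty B] {Ξ Θ : Op (A × B) →ₗ[ℂ] Op (A' × B')}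
    (h : IsLOCC Ξ) (h' : IsLOCC Θ) {p q : ℝ} (hp : 0 ≤ p) (hq : 0 ≤ q) (hpq : p + q = 1) :
    IsLOCC ((p : ℂ) • Ξ + (q : ℂ) • Θ) := by
  obtain ⟨Λ, h1, h2, h3⟩ := h.exists_block (C := A) (D := B)
  obtain ⟨Λ', h1', h2', h3'⟩ := h'.exists_block (C := A') (D := B')
  have hpq' : (p : ℂ) + q = 1 := by exact_mod_cast hpq
  -- The first party tosses a `(p, q)` coin and sends the result; both record it as a common block
  -- label. `Λ` then runs `Ξ` on the first blocks only, `swap` exchanges the blocks, `Λ'` runs `Θ`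
  -- on the other branch, and `merge` forgets the label.
  let mix : Op (A × B) →ₗ[ℂ] Op ((A ⊕ A) × (B ⊕ B)) :=
    ∑ a : Fin 2, tensorMap (![(p : ℂ) • inlMap A A, (q : ℂ) • inrMap A A] a)
      (![inlMap B B, inrMap B B] a)
  have hmix : IsOneWay mix := by
    refine Or.inl ⟨2, _, _, ?_, ?_, ?_, rfl⟩
    · intro a
      fin_cases a
      · exact isChannel_inlMap.1.smul (Complex.zero_le_real.2 hp)
      · exact isChannel_inrMap.1.smul (Complex.zero_le_real.2 hq)
    · simp only [Fin.sum_univ_two, Matrix.cons_val_zero, Matrix.cons_val_one]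
      refine ⟨(isChannel_inlMap.1.smul (Complex.zero_le_real.2 hp)).add
        (isChannel_inrMap.1.smul (Complex.zero_le_real.2 hq)), fun X => ?_⟩
      simp only [LinearMap.add_apply, LinearMap.smul_apply, Matrix.trace_add, Matrix.trace_smul,
        isChannel_inlMap.2, isChannel_inrMap.2, smul_eq_mul]
      rw [← add_mul, hpq', one_mul]
    · intro a
      fin_cases a
      · exact isChannel_inlMap
      · exact isChannel_inrMap
  have hmix' : mix = (p : ℂ) • tensorMap (inlMap A A) (inlMap B B) +
      (q : ℂ) • tensorMap (inrMap A A) (inrMap B B) := by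
    simp only [mix, Fin.sum_univ_two, Matrix.cons_val_zero, Matrix.cons_val_one]
    rfl
  let swap : Op ((A' ⊕ A) × (B' ⊕ B)) →ₗ[ℂ] Op ((A ⊕ A') × (B ⊕ B')) :=
    tensorMap (inrMap A A' ∘ₗ fstMap A' A + inlMap A A' ∘ₗ sndMap A' A)
      (inrMap B B' ∘ₗ fstMap B' B + inlMap B B' ∘ₗ sndMap B' B)
  have hswap : IsOneWay swap := isOneWay_tensorMap
    (isChannel_blocks isChannel_inrMap isChannel_inlMap)
    (isChannel_blocks isChannel_inrMap isChannel_inlMap)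
  let merge : Op ((A' ⊕ A') × (B' ⊕ B')) →ₗ[ℂ] Op (A' × B') :=
    tensorMap (LinearMap.id ∘ₗ fstMap A' A' + LinearMap.id ∘ₗ sndMap A' A')
      (LinearMap.id ∘ₗ fstMap B' B' + LinearMap.id ∘ₗ sndMap B' B')
  have hmerge : IsOneWay merge := isOneWay_tensorMap
    (isChannel_blocks IsChannel.id IsChannel.id) (isChannel_blocks IsChannel.id IsChannel.id)
  have s1 : swap ∘ₗ tensorMap (inlMap A' A) (inlMap B' B) =
      tensorMap (inrMap A A') (inrMap B B') := by
    simp only [swap, tensorMap_comp, LinearMap.add_comp, LinearMap.comp_assoc,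
      fstMap_comp_inlMap, sndMap_comp_inlMap, LinearMap.comp_id, LinearMap.comp_zero, add_zero]
  have s2 : swap ∘ₗ tensorMap (inrMap A' A) (inrMap B' B) =
      tensorMap (inlMap A A') (inlMap B B') := by
    simp only [swap, tensorMap_comp, LinearMap.add_comp, LinearMap.comp_assoc,
      fstMap_comp_inrMap, sndMap_comp_inrMap, LinearMap.comp_id, LinearMap.comp_zero, zero_add]
  have id_id : tensorMap (LinearMap.id : Op A' →ₗ[ℂ] Op A') (LinearMap.id : Op B' →ₗ[ℂ] Op B') =
      LinearMap.id := rfl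
  have m1 : merge ∘ₗ tensorMap (inlMap A' A') (inlMap B' B') = LinearMap.id := by
    simp only [merge, tensorMap_comp, LinearMap.add_comp, LinearMap.comp_assoc,
      fstMap_comp_inlMap, sndMap_comp_inlMap, LinearMap.comp_id, LinearMap.comp_zero, add_zero,
      id_id]
  have m2 : merge ∘ₗ tensorMap (inrMap A' A') (inrMap B' B') = LinearMap.id := by
    simp only [merge, tensorMap_comp, LinearMap.add_comp, LinearMap.comp_assoc,
      fstMap_comp_inrMap, sndMap_comp_inrMap, LinearMap.comp_id, LinearMap.comp_zero, zero_add,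
      id_id]
  have hall : IsLOCC (merge ∘ₗ Λ' ∘ₗ swap ∘ₗ Λ ∘ₗ mix) :=
    .comp ((((IsLOCC.oneWay hmix).trans h1).trans (.oneWay hswap)).trans h1') hmerge
  have e : merge ∘ₗ Λ' ∘ₗ swap ∘ₗ Λ ∘ₗ mix = (p : ℂ) • Ξ + (q : ℂ) • Θ := by
    rw [hmix']
    simp only [LinearMap.comp_add, LinearMap.comp_smul]
    rw [h2, h3, ← LinearMap.comp_assoc Ξ, s1, s2, ← LinearMap.comp_assoc Ξ, h3', h2',
      ← LinearMap.comp_assoc Ξ, m2, ← LinearMap.comp_assoc Θ, m1, LinearMap.id_comp,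
      LinearMap.id_comp]
  rwa [e] at hall

end BlockMaps

/-! ### Topology of maps and closed LOCC -/

section Closure

variable {A A' B B' C D S T : Type}

/-- The topology of pointwise convergence on linear maps between matrix spaces. -/
noncomputable instance instTopologicalSpaceMap : TopologicalSpace (Op S →ₗ[ℂ] Op T) :=
  TopologicalSpace.induced (fun Φ : Op S →ₗ[ℂ] Op T => (Φ : Op S → Op T)) inferInstance

theorem continuous_map_apply (X : Op S) : Continuous fun Φ : Op S →ₗ[ℂ] Op T => Φ X :=
  (continuous_apply X).comp continuous_induced_dom

theorem continuous_map_iff {Z : Type*} [TopologicalSpace Z] {f : Z → (Op S →ₗ[ℂ] Op T)} :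
    Continuous f ↔ ∀ X, Continuous fun z => f z X :=
  continuous_induced_rng.trans continuous_pi_iff

theorem continuous_op_iff {Z : Type*} [TopologicalSpace Z] {f : Z → Op S} :
    Continuous f ↔ ∀ i j, Continuous fun z => f z i j :=
  continuous_pi_iff.trans (forall_congr' fun _ => continuous_pi_iff)

theorem continuous_op_apply (i j : S) : Continuous fun X : Op S => X i j :=
  (continuous_apply j).comp (continuous_apply i)

theorem continuous_of_linear [Fintype S] (Φ : Op S →ₗ[ℂ] Op T) : Continuous Φ := by
  refine continuous_op_iff.2 fun i j => ?_
  exact LinearMap.continuous_of_finiteDimensional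
    (LinearMap.comp (Matrix.entryLinearMap ℂ ℂ i j) Φ)

theorem isClosed_posSemidef [Fintype S] : IsClosed {X : Op S | X.PosSemidef} := by
  have h : {X : Op S | X.PosSemidef} = {X : Op S | X.conjTranspose = X} ∩
      ⋂ v : S → ℂ, {X : Op S | 0 ≤ star v ⬝ᵥ (X.mulVec v)} := by
    ext X
    rw [Set.mem_ofPred_eq, Matrix.posSemidef_iff_dotProduct_mulVec]
    simp [Matrix.IsHermitian]
  rw [h]
  refine IsClosed.inter ?_ (isClosed_iInter fun v => ?_)
  · exact isClosed_eq (by fun_prop) continuous_id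
  · refine isClosed_Ici.preimage (f := fun X : Op S => star v ⬝ᵥ (X.mulVec v)) ?_
    fun_prop

theorem isClosed_isChannel [Fintype S] [Fintype T] :
    IsClosed {Φ : Op S →ₗ[ℂ] Op T | IsChannel Φ} := by
  have h : {Φ : Op S →ₗ[ℂ] Op T | IsChannel Φ} =
      (⋂ (k : ℕ) (X : Op (S × Fin k)) (_ : X.PosSemidef), {Φ : Op S →ₗ[ℂ] Op T |
        (tensorMap Φ (LinearMap.id : Op (Fin k) →ₗ[ℂ] Op (Fin k)) X).PosSemidef}) ∩
      ⋂ X : Op S, {Φ : Op S →ₗ[ℂ] Op T | (Φ X).trace = X.trace} := by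
    ext Φ
    simp [IsChannel, IsCP]
  rw [h]
  refine IsClosed.inter ?_ (isClosed_iInter fun X => ?_)
  · refine isClosed_iInter fun k => isClosed_iInter fun X => isClosed_iInter fun _ => ?_
    refine isClosed_posSemidef.preimage (continuous_op_iff.2 fun i j => ?_)
    exact (continuous_op_apply i.1 j.1).comp
      (continuous_map_apply (Matrix.of fun a c => X (a, i.2) (c, j.2)))
  · exact isClosed_eq (continuous_map_apply X).matrix_trace continuous_const

variable [Fintype A] [Fintype B] [Fintype C] [Fintype D]

theorem closedLOCC_eq_closure :
    closedLOCC A B = closure {Φ : Op (A × B) →ₗ[ℂ] Op (A × B) | IsLOCC Φ} := by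
  ext Φ
  exact closure_induced.symm

theorem isClosed_closedLOCC : IsClosed (closedLOCC A B) := by
  rw [closedLOCC_eq_closure]; exact isClosed_closure

theorem isChannel_of_mem_closedLOCC {Φ : Op (A × B) →ₗ[ℂ] Op (A × B)}
    (h : Φ ∈ closedLOCC A B) : IsChannel Φ := by
  rw [closedLOCC_eq_closure] at h
  exact closure_minimal (fun Ψ (hΨ : IsLOCC Ψ) => hΨ.isChannel) isClosed_isChannel h

/-- A map of two variables, separately continuous, sends closures to closures. -/
theorem map_mem_closure_of_separately {X Y Z : Type*} [TopologicalSpace X] [TopologicalSpace Y]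
    [TopologicalSpace Z] {f : X → Y → Z} (hl : ∀ y, Continuous fun x => f x y)
    (hr : ∀ x, Continuous (f x)) {s : Set X} {t : Set Y} {u : Set Z}
    (h : ∀ x ∈ s, ∀ y ∈ t, f x y ∈ u) {x : X} (hx : x ∈ closure s) {y : Y} (hy : y ∈ closure t) :
    f x y ∈ closure u := by
  -- The limit is taken in one variable at a time, so joint continuity is not needed.
  have h1 : ∀ x ∈ s, f x y ∈ closure u := fun x hx => map_mem_closure (hr x) hy (h x hx)
  simpa using map_mem_closure (hl y) hx h1

theorem closedLOCC_comp {Φ Ψ : Op (A × B) →ₗ[ℂ] Op (A × B)} (h : Φ ∈ closedLOCC A B)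
    (h' : Ψ ∈ closedLOCC A B) : Φ ∘ₗ Ψ ∈ closedLOCC A B := by
  rw [closedLOCC_eq_closure] at *
  refine map_mem_closure_of_separately
    (f := fun Φ Ψ : Op (A × B) →ₗ[ℂ] Op (A × B) => Φ ∘ₗ Ψ) (fun Ψ => ?_) (fun Φ => ?_)
    (fun Φ (hΦ : IsLOCC Φ) Ψ (hΨ : IsLOCC Ψ) => hΨ.trans hΦ) h h'
  · exact continuous_map_iff.2 fun X => continuous_map_apply (Ψ X)
  · exact continuous_map_iff.2 fun X => (continuous_of_linear Φ).comp (continuous_map_apply X)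

theorem closedLOCC_convex [Nonempty A] [Nonempty B] {Φ Ψ : Op (A × B) →ₗ[ℂ] Op (A × B)}
    (h : Φ ∈ closedLOCC A B) (h' : Ψ ∈ closedLOCC A B) {p q : ℝ} (hp : 0 ≤ p) (hq : 0 ≤ q)
    (hpq : p + q = 1) : (p : ℂ) • Φ + (q : ℂ) • Ψ ∈ closedLOCC A B := by
  rw [closedLOCC_eq_closure] at *
  refine map_mem_closure_of_separately
    (f := fun Φ Ψ : Op (A × B) →ₗ[ℂ] Op (A × B) => (p : ℂ) • Φ + (q : ℂ) • Ψ)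
    (fun Ψ => ?_) (fun Φ => ?_)
    (fun Φ (hΦ : IsLOCC Φ) Ψ (hΨ : IsLOCC Ψ) => hΦ.convex hΨ hp hq hpq) h h'
  · exact continuous_map_iff.2 fun X =>
      ((continuous_map_apply X).const_smul (p : ℂ)).add continuous_const
  · exact continuous_map_iff.2 fun X =>
      continuous_const.add ((continuous_map_apply X).const_smul (q : ℂ))

theorem isChannel_ancillaMap {Φ : Op (A × B) →ₗ[ℂ] Op (A × B)} (h : IsChannel Φ) :
    IsChannel (ancillaMap C D Φ) := by
  refine ⟨h.1.ancillaMap, fun X => ?_⟩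
  have h1 : IsChannel (tensorMap Φ (LinearMap.id : Op (C × D) →ₗ[ℂ] Op (C × D))) :=
    h.tensorMap IsChannel.id
  have h2 : ∀ {P Q : Type} [Fintype P] [Fintype Q] (e : P ≃ Q) (Y : Op Q),
      (Y.submatrix e e).trace = Y.trace := fun e Y => by
    simp only [Matrix.trace, Matrix.diag_apply, Matrix.submatrix_apply]
    exact Equiv.sum_comp e fun i => Y i i
  exact (h2 (Equiv.prodProdProdComm A B C D).symm _).trans ((h1.2 _).trans (h2 _ X))

end Closure

/-! ### Measurements as channels, and their pullbacks -/

section Measurement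

variable {A B C D S T ι : Type} [Fintype A] [Fintype B] [Fintype C] [Fintype D] [Fintype S]
  [DecidableEq A] [DecidableEq B] [DecidableEq C] [DecidableEq D] [DecidableEq S]

/-- Splitting each `M x` into rank-one terms `v v†` gives the Kraus operators `|x⟩⟨v|`. -/
theorem measurementChannel_isChannel [Fintype ι] [DecidableEq ι] {M : ι → Op S}
    (hM : IsPOVM M) : IsChannel (measurementChannel M) := by
  refine ⟨?_, fun X => ?_⟩
  · have h : ∀ x, ∃ (m : ℕ) (v : Fin m → S → ℂ),
        M x = ∑ i, Matrix.vecMulVec (v i) (star (v i)) := fun x =>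
      Matrix.posSemidef_iff_eq_sum_vecMulVec.1 (hM.1 x)
    choose m v hv using h
    have e : measurementChannel M = ∑ x, ∑ i, conjMap
        (Matrix.vecMulVec (Pi.single x 1 : ι → ℂ) (star (v x i))) := by
      refine LinearMap.ext fun X => ?_
      simp only [LinearMap.sum_apply]
      change Matrix.diagonal _ = ∑ x, ∑ i, Matrix.vecMulVec (Pi.single x 1 : ι → ℂ) (star (v x i)) *
        X * (Matrix.vecMulVec (Pi.single x 1 : ι → ℂ) (star (v x i))).conjTranspose
      have e1 : ∀ x (i : Fin (m x)),
          Matrix.vecMulVec (Pi.single x 1 : ι → ℂ) (star (v x i)) * X *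
            (Matrix.vecMulVec (Pi.single x 1 : ι → ℂ) (star (v x i))).conjTranspose =
          Matrix.diagonal (Pi.single x (Matrix.vecMulVec (v x i) (star (v x i)) * X).trace) := by
        intro x i
        rw [Matrix.conjTranspose_vecMulVec, star_star, Matrix.vecMulVec_mul,
          Matrix.vecMulVec_mul_vecMulVec, Matrix.vecMulVec_mul, Matrix.trace_vecMulVec,
          dotProduct_comm]
        ext a b
        rcases eq_or_ne a b with rfl | hab
        · by_cases ha : a = x <;> simp [Matrix.vecMulVec_apply, ha]
        · rw [Matrix.diagonal_apply_ne _ hab]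
          by_cases ha : a = x
          · subst ha
            simp [Matrix.vecMulVec_apply, hab.symm]
          · simp [Matrix.vecMulVec_apply, ha]
      simp only [e1]
      ext a b
      simp only [Matrix.sum_apply, Matrix.diagonal_apply]
      split_ifs with hab
      · rw [Finset.sum_eq_single a]
        · simp only [Pi.single_eq_same]
          rw [hv a, Finset.sum_mul, Matrix.trace_sum]
        · intro x _ hx
          exact Finset.sum_eq_zero fun i _ => Pi.single_eq_of_ne hx.symm _
        · simp
      · simp
    rw [e]
    exact IsCP.sum _ fun x _ => IsCP.sum _ fun i _ => isCP_conjMap _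
  · change (Matrix.diagonal fun x => (M x * X).trace).trace = _
    rw [Matrix.trace_diagonal, ← Matrix.trace_sum, ← Finset.sum_mul, hM.2, Matrix.one_mul]

theorem dualMap_one [Fintype T] [DecidableEq T] {Φ : Op S →ₗ[ℂ] Op T} (h : IsChannel Φ) :
    dualMap Φ 1 = 1 := by
  ext i j
  simp only [dualMap, Matrix.of_apply, Matrix.one_mul, h.2]
  by_cases hij : i = j
  · subst hij; simp
  · rw [Matrix.trace_single_eq_of_ne _ _ _ (Ne.symm hij), Matrix.one_apply_ne hij]

/-- The dual of a linear map, as a linear map. -/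
def dualLinearMap [Fintype T] (Φ : Op S →ₗ[ℂ] Op T) : Op T →ₗ[ℂ] Op S where
  toFun := dualMap Φ
  map_add' X Y := by ext i j; simp [dualMap, Matrix.add_mul]
  map_smul' c X := by ext i j; simp [dualMap]

theorem isPOVM_measAfter [Fintype ι] {M : ι → Op S} (hM : IsPOVM M) {Φ : Op S →ₗ[ℂ] Op S}
    (h : IsChannel Φ) : IsPOVM (measAfter M Φ) := by
  refine ⟨fun x => h.1.dualMap_posSemidef (hM.1 x), ?_⟩
  have := map_sum (dualLinearMap Φ) M Finset.univ
  rw [hM.2] at this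
  exact this.symm.trans (dualMap_one h)

theorem isPOVM_of_mem_closedLOCCMeasurements {n : ℕ} {M : Fin n × Fin n → Op (A × B)}
    (h : M ∈ closedLOCCMeasurements A B n) : IsPOVM M := by
  refine closure_minimal (t := {M : Fin n × Fin n → Op (A × B) | IsPOVM M})
    (fun M hM => hM.1) ?_ h
  have e : {M : Fin n × Fin n → Op (A × B) | IsPOVM M} =
      (⋂ x, {M : Fin n × Fin n → Op (A × B) | (M x).PosSemidef}) ∩
        {M : Fin n × Fin n → Op (A × B) | ∑ x, M x = 1} := by
    ext M; simp [IsPOVM]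
  rw [e]
  refine IsClosed.inter (isClosed_iInter fun x => ?_) ?_
  · exact (isClosed_posSemidef (S := A × B)).preimage
      (continuous_apply (A := fun _ : Fin n × Fin n => Op (A × B)) x)
  · exact isClosed_eq (continuous_finsetSum _ fun x _ => continuous_apply x) continuous_const

/-- This lets the post-processing `K` be absorbed into the measurement. For genuinely LOCC data it
is composition of channels; the pullback is separately continuous in `M` and `K`, which extends it
to the closures. -/
theorem measAfter_ancillaMap_mem {n : ℕ} {M : Fin n × Fin n → Op ((A × C) × (B × D))}
    (hM : M ∈ closedLOCCMeasurements (A × C) (B × D) n) {K : Op (A × B) →ₗ[ℂ] Op (A × B)}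
    (hK : K ∈ closedLOCC A B) :
    measAfter M (ancillaMap C D K) ∈ closedLOCCMeasurements (A × C) (B × D) n := by
  rw [closedLOCC_eq_closure] at hK
  refine map_mem_closure_of_separately (f := fun M K => measAfter M (ancillaMap C D K))
    (fun K => ?_) (fun M => ?_) (fun M hM K (hK : IsLOCC K) => ?_) hM hK
  · exact continuous_pi fun x =>
      (continuous_of_linear (dualLinearMap (ancillaMap C D K))).comp (continuous_apply x)
  · refine continuous_pi fun x => continuous_op_iff.2 fun i j => ?_
    refine Continuous.matrix_trace (Continuous.matrix_mul continuous_const ?_)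
    exact continuous_op_iff.2 fun p q => (continuous_op_apply (p.1.1, p.2.1) (q.1.1, q.2.1)).comp
      (continuous_map_apply (Matrix.of fun a b : A × B => Matrix.single j i (1 : ℂ)
        ((a.1, p.1.2), (a.2, p.2.2)) ((b.1, q.1.2), (b.2, q.2.2))))
  · refine ⟨isPOVM_measAfter hM.1 (isChannel_ancillaMap hK.isChannel), ?_⟩
    rw [measurementChannel_measAfter]
    exact hK.ancillaMap.trans hM.2

theorem measAfter_comp (M : ι → Op S) (Φ Ψ : Op S →ₗ[ℂ] Op S) :
    measAfter M (Φ ∘ₗ Ψ) = measAfter (measAfter M Φ) Ψ := by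
  funext x
  ext i j
  simp only [measAfter]
  rw [dualMap, dualMap, Matrix.of_apply, Matrix.of_apply, trace_dualMap_mul]
  rfl

end Measurement

/-! ### Product measurements and the span of effects -/

section Effects

/-- Every effect is the first element of a POVM with any number `m + 2` of outcomes. -/
theorem exists_isPOVM_of_effect {S : Type} [DecidableEq S] (m : ℕ) {P : Op S} (hP : P.PosSemidef)
    (hP' : (1 - P).PosSemidef) : ∃ M : Fin (m + 2) → Op S, IsPOVM M ∧ M 0 = P := by
  refine ⟨Fin.cons P (Fin.cons (1 - P) fun _ => 0), ⟨fun x => ?_, ?_⟩, rfl⟩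
  · refine Fin.cases ?_ (fun x => Fin.cases ?_ (fun x => ?_) x) x
    · exact hP
    · exact hP'
    · exact Matrix.PosSemidef.zero
  · simp [Fin.sum_univ_succ]

theorem measurementChannel_kronecker {S T ι κ : Type} [DecidableEq ι] [DecidableEq κ] [Fintype S]
    [Fintype T]
    (P : ι → Op S) (Q : κ → Op T) :
    measurementChannel (fun x : ι × κ => (Matrix.kronecker (P x.1) (Q x.2) : Op (S × T))) =
      tensorMap (measurementChannel P) (measurementChannel Q) := by
  refine ext_kronecker fun X Y => ?_
  rw [tensorMap_kronecker]
  change Matrix.diagonal (fun x : ι × κ =>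
    ((Matrix.kronecker (P x.1) (Q x.2) : Op (S × T)) * Matrix.kronecker X Y).trace) =
    Matrix.kronecker (Matrix.diagonal fun x => (P x * X).trace)
      (Matrix.diagonal fun x => (Q x * Y).trace)
  unfold Matrix.kronecker
  rw [Matrix.diagonal_kronecker_diagonal]
  congr 1
  funext x
  rw [← Matrix.mul_kronecker_mul, Matrix.trace_kronecker]

variable {S T : Type} [Fintype S] [DecidableEq S] [Fintype T] [DecidableEq T]

theorem ofSpectrum_posSemidef (U : Op S) {x : S → ℝ} (hx : ∀ i, 0 ≤ x i) :
    (ofSpectrum U x).PosSemidef :=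
  (Matrix.PosSemidef.diagonal fun i => Complex.zero_le_real.2 (hx i)).mul_mul_conjTranspose_same U

theorem ofSpectrum_eq_sum (U : Op S) (x : S → ℝ) :
    ofSpectrum U x = ∑ i, (x i : ℂ) • ofSpectrum U (Pi.single i 1) := by
  have h : (Matrix.diagonal fun i => (x i : ℂ)) =
      ∑ i, (x i : ℂ) • Matrix.diagonal fun j => ((Pi.single i 1 : S → ℝ) j : ℂ) := by
    ext a b
    simp only [Matrix.sum_apply, Matrix.smul_apply, Matrix.diagonal_apply]
    split_ifs with hab
    · rw [Finset.sum_eq_single a] <;> simp +contextual [eq_comm]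
    · simp
  rw [ofSpectrum, h, Finset.mul_sum, Finset.sum_mul]
  simp [ofSpectrum]

/-- Effects `0 ≤ P ≤ 1` span the space of all operators. -/
theorem effect_induction {p : Op S → Prop} (hadd : ∀ X Y, p X → p Y → p (X + Y))
    (hsmul : ∀ (c : ℂ) X, p X → p (c • X))
    (h : ∀ P : Op S, P.PosSemidef → (1 - P).PosSemidef → p P) (X : Op S) : p X := by
  have herm : ∀ H : Op S, H.IsHermitian → p H := by
    intro H hH
    obtain ⟨U, x, -, hU, -, hHs, -⟩ := exists_ofSpectrum hH
    rw [hHs, ofSpectrum_eq_sum]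
    refine Finset.sum_induction _ p hadd
      (h 0 Matrix.PosSemidef.zero (by simpa using Matrix.PosSemidef.one)) fun i _ =>
      hsmul _ _ (h _ (ofSpectrum_posSemidef U fun j => ?_) ?_)
    · by_cases hj : j = i <;> simp [hj]
    · have e : 1 - ofSpectrum U (Pi.single i 1) =
          ofSpectrum U (fun j => 1 - (Pi.single i 1 : S → ℝ) j) := by
        have e1 : (1 : Op S) = ofSpectrum U fun _ => 1 := by simp [ofSpectrum, hU]
        have e2 : (Matrix.diagonal fun j => ((1 - (Pi.single i 1 : S → ℝ) j : ℝ) : ℂ)) =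
            Matrix.diagonal (fun _ => ((1 : ℝ) : ℂ)) -
              Matrix.diagonal fun j => ((Pi.single i 1 : S → ℝ) j : ℂ) := by
          rw [Matrix.diagonal_sub]; simp
        rw [e1]
        simp only [ofSpectrum]
        rw [e2, Matrix.mul_sub, Matrix.sub_mul]
      rw [e]
      refine ofSpectrum_posSemidef U fun j => ?_
      by_cases hj : j = i <;> simp [hj]
  rw [← realPart_add_I_smul_imaginaryPart X]
  exact hadd _ _ (herm _ (realPart X).2) (hsmul _ _ (herm _ (imaginaryPart X).2))

theorem isPOVM_kronecker {ι κ : Type} [Fintype ι] [Fintype κ] {P : ι → Op S} {Q : κ → Op T}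
    (hP : IsPOVM P) (hQ : IsPOVM Q) :
    IsPOVM fun x : ι × κ => (Matrix.kronecker (P x.1) (Q x.2) : Op (S × T)) := by
  refine ⟨fun x => (hP.1 x.1).kronecker (hQ.1 x.2), ?_⟩
  rw [← Matrix.one_kronecker_one, ← hP.2, ← hQ.2]
  ext p q
  simp only [Matrix.sum_apply, Matrix.kronecker, Matrix.kroneckerMap_apply]
  rw [Fintype.sum_prod_type, Finset.sum_mul_sum]

theorem kronecker_mem_closedLOCCMeasurements {n : ℕ} {P : Fin n → Op S} {Q : Fin n → Op T}
    (hP : IsPOVM P) (hQ : IsPOVM Q) :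
    (fun x : Fin n × Fin n => (Matrix.kronecker (P x.1) (Q x.2) : Op (S × T))) ∈
      closedLOCCMeasurements S T n := by
  refine subset_closure ⟨isPOVM_kronecker hP hQ, ?_⟩
  rw [measurementChannel_kronecker]
  exact .oneWay (isOneWay_tensorMap (measurementChannel_isChannel hP)
    (measurementChannel_isChannel hQ))

/-- Two outcomes per party accommodate an effect and its complement; further outcomes are padded by
zero. No communication is needed. -/
theorem exists_measurement_of_effects {n : ℕ} (hn : 2 ≤ n) {P : Op S} {Q : Op T}
    (hP : P.PosSemidef) (hP' : (1 - P).PosSemidef) (hQ : Q.PosSemidef)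
    (hQ' : (1 - Q).PosSemidef) :
    ∃ M ∈ closedLOCCMeasurements S T n, ∃ x, M x = Matrix.kronecker P Q := by
  obtain ⟨m, rfl⟩ := Nat.exists_eq_add_of_le' hn
  obtain ⟨M, hM, rfl⟩ := exists_isPOVM_of_effect m hP hP'
  obtain ⟨M', hM', rfl⟩ := exists_isPOVM_of_effect m hQ hQ'
  exact ⟨_, kronecker_mem_closedLOCCMeasurements hM hM', (0, 0), rfl⟩

end Effects

/-! ### Measurement relative entropy: Pinsker-type bound and convexity -/

section MeasRelEntropy

theorem coe_sum_eReal {ι : Type*} (s : Finset ι) (f : ι → ℝ) :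
    ((∑ x ∈ s, f x : ℝ) : EReal) = ∑ x ∈ s, (f x : EReal) :=
  map_sum (⟨⟨Real.toEReal, EReal.coe_zero⟩, EReal.coe_add⟩ : ℝ →+ EReal) f s

theorem mul_sum_of_ne_top {ι : Type*} {c : EReal} (hc : 0 ≤ c) (hc' : c ≠ ⊤) (s : Finset ι) (f : ι → EReal) :
    c * ∑ x ∈ s, f x = ∑ x ∈ s, c * f x := by
  classical
  induction s using Finset.induction_on with
  | empty => simp
  | insert a s ha ih =>
    rw [Finset.sum_insert ha, Finset.sum_insert ha,
      EReal.left_distrib_of_nonneg_of_ne_top hc hc', ih]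

theorem trace_sq_of_isHermitian {S : Type} [Fintype S] {Z : Op S} (h : Z.IsHermitian) :
    (Z * Z).trace.re = ∑ i, ∑ j, Complex.normSq (Z i j) := by
  simp only [Matrix.trace, Matrix.diag_apply, Matrix.mul_apply, Complex.re_sum]
  refine Finset.sum_congr rfl fun i _ => Finset.sum_congr rfl fun j _ => ?_
  rw [← h.apply j i, Complex.star_def, Complex.mul_conj, Complex.ofReal_re]

theorem IsPOVM.one_sub_posSemidef {S ι : Type} [DecidableEq S] [Fintype ι] {M : ι → Op S} (h : IsPOVM M) (x : ι) :
    (1 - M x).PosSemidef := by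
  classical
  rw [← h.2, ← Finset.sum_erase_eq_sub (Finset.mem_univ x)]
  exact Matrix.posSemidef_sum _ fun y _ => h.1 y

variable {S ι : Type} [Fintype S] [DecidableEq S] [Fintype ι]

/-- Pinsker-type bound for the measurement relative entropy. -/
theorem sum_trace_sq_le_measRelEntropy {M N : ι → Op S} (hM : IsPOVM M) (hN : IsPOVM N) :
    (((Fintype.card S : ℝ)⁻¹ * ∑ x, ∑ i, ∑ j, Complex.normSq ((M x - N x) i j) / 4 : ℝ) : EReal) ≤
      measRelEntropy M N := by
  unfold measRelEntropy
  rw [EReal.coe_mul]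
  refine mul_le_mul_of_nonneg_left ?_ (EReal.coe_nonneg.2 (by positivity))
  have h : ∑ x, ∑ i, ∑ j, Complex.normSq ((M x - N x) i j) / 4 =
      ∑ x, ((M x).trace.re - (N x).trace.re + ((M x - N x) * (M x - N x)).trace.re / 4) := by
    -- The linear trace terms cancel after summation, because both POVMs sum to the identity.
    rw [Finset.sum_add_distrib, Finset.sum_sub_distrib, ← Complex.re_sum, ← Complex.re_sum,
      ← Matrix.trace_sum, ← Matrix.trace_sum, hM.2, hN.2, sub_self, zero_add]
    refine Finset.sum_congr rfl fun x _ => ?_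
    rw [trace_sq_of_isHermitian ((hM.1 x).1.sub (hN.1 x).1), Finset.sum_div]
    simp only [Finset.sum_div]
  rw [h, coe_sum_eReal]
  exact Finset.sum_le_sum fun x _ => trace_sub_add_le_relEntropy (hM.1 x) (hN.1 x)
    (hM.one_sub_posSemidef x) (hN.one_sub_posSemidef x)

theorem measRelEntropy_nonneg {M N : ι → Op S} (hM : IsPOVM M) (hN : IsPOVM N) :
    0 ≤ measRelEntropy M N := by
  refine le_trans (EReal.coe_nonneg.2 ?_) (sum_trace_sq_le_measRelEntropy hM hN)
  exact mul_nonneg (by positivity) (Finset.sum_nonneg fun x _ => Finset.sum_nonneg fun i _ =>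
    Finset.sum_nonneg fun j _ => div_nonneg (Complex.normSq_nonneg _) (by norm_num))

theorem normSq_sub_le_of_measRelEntropy_le [Nonempty S] {M N : ι → Op S} (hM : IsPOVM M)
    (hN : IsPOVM N) {ε : ℝ} (h : measRelEntropy M N ≤ ε) (x : ι) (i j : S) :
    Complex.normSq (M x i j - N x i j) ≤ 4 * Fintype.card S * ε := by
  have h1 := EReal.coe_le_coe_iff.1 ((sum_trace_sq_le_measRelEntropy hM hN).trans h)
  have hc : (0 : ℝ) < Fintype.card S := by exact_mod_cast Fintype.card_pos
  rw [inv_mul_le_iff₀ hc] at h1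
  have nn : ∀ x i j, 0 ≤ Complex.normSq ((M x - N x) i j) / 4 := fun x i j =>
    div_nonneg (Complex.normSq_nonneg _) (by norm_num)
  have h2 : Complex.normSq ((M x - N x) i j) / 4 ≤
      ∑ x, ∑ i, ∑ j, Complex.normSq ((M x - N x) i j) / 4 := by
    refine le_trans (Finset.single_le_sum (f := fun j => Complex.normSq ((M x - N x) i j) / 4)
      (fun j _ => nn x i j) (Finset.mem_univ j)) ?_
    refine le_trans (Finset.single_le_sum
      (f := fun i => ∑ j, Complex.normSq ((M x - N x) i j) / 4)
      (fun i _ => Finset.sum_nonneg fun j _ => nn x i j) (Finset.mem_univ i)) ?_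
    exact Finset.single_le_sum
      (f := fun x => ∑ i, ∑ j, Complex.normSq ((M x - N x) i j) / 4)
      (fun x _ => Finset.sum_nonneg fun i _ => Finset.sum_nonneg fun j _ => nn x i j)
      (Finset.mem_univ x)
  rw [Matrix.sub_apply] at h2
  linarith

theorem measRelEntropy_self (M : ι → Op S) : measRelEntropy M M = 0 := by
  simp [measRelEntropy, relEntropy_self]

theorem measRelEntropy_mono {M N M' N' : ι → Op S}
    (h : ∀ x, relEntropy (M x) (N x) ≤ relEntropy (M' x) (N' x)) :
    measRelEntropy M N ≤ measRelEntropy M' N' :=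
  mul_le_mul_of_nonneg_left (Finset.sum_le_sum fun x _ => h x)
    (EReal.coe_nonneg.2 (by positivity))

theorem measRelEntropy_convex {M₁ N₁ M₂ N₂ : ι → Op S} (hM₁ : IsPOVM M₁) (hN₁ : IsPOVM N₁)
    (hM₂ : IsPOVM M₂) (hN₂ : IsPOVM N₂) {p q : ℝ} (hp : 0 < p) (hq : 0 < q) :
    measRelEntropy (fun x => (p : ℂ) • M₁ x + (q : ℂ) • M₂ x)
      (fun x => (p : ℂ) • N₁ x + (q : ℂ) • N₂ x) ≤
      (p : EReal) * measRelEntropy M₁ N₁ + (q : EReal) * measRelEntropy M₂ N₂ := by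
  have hc : (0 : EReal) ≤ (((Fintype.card S : ℝ)⁻¹ : ℝ) : EReal) :=
    EReal.coe_nonneg.2 (by positivity)
  unfold measRelEntropy
  rw [mul_left_comm (p : EReal), mul_left_comm (q : EReal),
    ← EReal.left_distrib_of_nonneg_of_ne_top hc (EReal.coe_ne_top _),
    mul_sum_of_ne_top (EReal.coe_nonneg.2 hp.le) (EReal.coe_ne_top _),
    mul_sum_of_ne_top (EReal.coe_nonneg.2 hq.le) (EReal.coe_ne_top _), ← Finset.sum_add_distrib]
  exact mul_le_mul_of_nonneg_left (Finset.sum_le_sum fun x _ => relEntropy_convex (hM₁.1 x)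
    (hN₁.1 x) (hM₂.1 x) (hN₂.1 x) hp hq) hc

end MeasRelEntropy

/-! ### Monotonicity, convexity and faithfulness of the power -/

section Power

theorem ancillaMap_map_one {A B C D : Type} [DecidableEq A] [DecidableEq B] [DecidableEq C]
    [DecidableEq D]
    {L : Op (A × B) →ₗ[ℂ] Op (A × B)} (h : L 1 = 1) : ancillaMap C D L 1 = 1 := by
  ext ⟨⟨a, c⟩, b, d⟩ ⟨⟨a', c'⟩, b', d'⟩
  rw [ancillaMap_apply]
  have e : (Matrix.of fun p q : A × B => (1 : Op ((A × C) × (B × D)))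
      ((p.1, c), (p.2, d)) ((q.1, c'), (q.2, d'))) =
      ((1 : Op C) c c' * (1 : Op D) d d') • (1 : Op (A × B)) := by
    ext p q
    simp only [Matrix.of_apply, Matrix.one_apply, Matrix.smul_apply, Prod.ext_iff, smul_eq_mul]
    split_ifs <;> simp_all
  rw [e, map_smul, h]
  simp only [Matrix.one_apply, Matrix.smul_apply, Prod.ext_iff, smul_eq_mul]
  split_ifs <;> simp_all

variable {A B : Type} [Fintype A] [Fintype B] [DecidableEq A] [DecidableEq B]

/-- The largest measurement relative entropy between `Φ` and `F` over closed-LOCC measurements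
with ancillas. -/
noncomputable def measDivergence (N : Set ℕ) (Φ F : Op (A × B) →ₗ[ℂ] Op (A × B)) : EReal :=
  ⨆ (k : ℕ) (l : ℕ), ⨆ n ∈ N,
    ⨆ M ∈ closedLOCCMeasurements (A × Fin (k + 1)) (B × Fin (l + 1)) n,
      measRelEntropy (measAfter M (withAncilla (Fin (k + 1)) (Fin (l + 1)) Φ))
        (measAfter M (withAncilla (Fin (k + 1)) (Fin (l + 1)) F))

theorem measEntanglingPower_le (N : Set ℕ) (Φ : Op (A × B) →ₗ[ℂ] Op (A × B))
    {F : Op (A × B) →ₗ[ℂ] Op (A × B)} (hF : F ∈ closedLOCC A B) :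
    measEntanglingPower N Φ ≤ measDivergence N Φ F :=
  iInf₂_le F hF

theorem measDivergence_le {N : Set ℕ} {Φ F : Op (A × B) →ₗ[ℂ] Op (A × B)} {c : EReal}
    (h : ∀ (k l n : ℕ), n ∈ N →
      ∀ M ∈ closedLOCCMeasurements (A × Fin (k + 1)) (B × Fin (l + 1)) n,
      measRelEntropy (measAfter M (ancillaMap (Fin (k + 1)) (Fin (l + 1)) Φ))
        (measAfter M (ancillaMap (Fin (k + 1)) (Fin (l + 1)) F)) ≤ c) :
    measDivergence N Φ F ≤ c :=
  iSup_le fun k => iSup_le fun l => iSup₂_le fun n hn => iSup₂_le fun M hM => h k l n hn M hM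

/-- For maps on `A × B`, `ancillaMap` and `withAncilla` agree definitionally, so lemmas on
`ancillaMap` apply to the divergence. -/
theorem le_measDivergence {N : Set ℕ} (Φ F : Op (A × B) →ₗ[ℂ] Op (A × B)) {k l n : ℕ} (hn : n ∈ N)
    {M : Fin n × Fin n → Op ((A × Fin (k + 1)) × (B × Fin (l + 1)))}
    (hM : M ∈ closedLOCCMeasurements (A × Fin (k + 1)) (B × Fin (l + 1)) n) :
    measRelEntropy (measAfter M (ancillaMap (Fin (k + 1)) (Fin (l + 1)) Φ))
        (measAfter M (ancillaMap (Fin (k + 1)) (Fin (l + 1)) F)) ≤ measDivergence N Φ F :=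
  le_iSup₂_of_le (f := fun k l : ℕ => ⨆ n ∈ N,
    ⨆ M ∈ closedLOCCMeasurements (A × Fin (k + 1)) (B × Fin (l + 1)) n,
      measRelEntropy (measAfter M (ancillaMap (Fin (k + 1)) (Fin (l + 1)) Φ))
        (measAfter M (ancillaMap (Fin (k + 1)) (Fin (l + 1)) F))) k l
    (le_iSup₂_of_le n hn (le_iSup₂_of_le (f := fun M
      (_ : M ∈ closedLOCCMeasurements (A × Fin (k + 1)) (B × Fin (l + 1)) n) =>
      measRelEntropy (measAfter M (ancillaMap (Fin (k + 1)) (Fin (l + 1)) Φ))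
        (measAfter M (ancillaMap (Fin (k + 1)) (Fin (l + 1)) F))) M hM le_rfl))

theorem measDivergence_self_le (N : Set ℕ) (Φ : Op (A × B) →ₗ[ℂ] Op (A × B)) :
    measDivergence N Φ Φ ≤ 0 :=
  measDivergence_le fun _ _ _ _ _ _ => (measRelEntropy_self _).le

theorem measDivergence_nonneg {N : Set ℕ} (hN : ∃ n ∈ N, 2 ≤ n)
    {Φ F : Op (A × B) →ₗ[ℂ] Op (A × B)} (hΦ : IsChannel Φ) (hF : IsChannel F) :
    0 ≤ measDivergence N Φ F := by
  obtain ⟨n, hn, hn2⟩ := hN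
  obtain ⟨M, hM, -⟩ := exists_measurement_of_effects (S := A × Fin (0 + 1))
    (T := B × Fin (0 + 1)) hn2 Matrix.PosSemidef.one (by simpa using Matrix.PosSemidef.zero)
    Matrix.PosSemidef.one (by simpa using Matrix.PosSemidef.zero)
  have hM' := isPOVM_of_mem_closedLOCCMeasurements hM
  exact (measRelEntropy_nonneg (isPOVM_measAfter hM' (isChannel_ancillaMap hΦ))
    (isPOVM_measAfter hM' (isChannel_ancillaMap hF))).trans (le_measDivergence Φ F hn hM)

theorem measEntanglingPower_nonneg {N : Set ℕ} (hN : ∃ n ∈ N, 2 ≤ n)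
    {Φ : Op (A × B) →ₗ[ℂ] Op (A × B)} (hΦ : IsChannel Φ) : 0 ≤ measEntanglingPower N Φ :=
  le_iInf₂ fun _ hF => measDivergence_nonneg hN hΦ (isChannel_of_mem_closedLOCC hF)

/-- Any measurement after `K` is itself an admissible measurement, and precomposing with the unital
`L` acts on the POVM elements by `L†`, to which data processing applies. -/
theorem measDivergence_comp_le (N : Set ℕ) {Φ F K L : Op (A × B) →ₗ[ℂ] Op (A × B)}
    (hΦ : IsChannel Φ) (hF : IsChannel F) (hK : K ∈ closedLOCC A B) (hL : IsChannel L)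
    (hL1 : L 1 = 1) :
    measDivergence N (K ∘ₗ Φ ∘ₗ L) (K ∘ₗ F ∘ₗ L) ≤ measDivergence N Φ F := by
  refine measDivergence_le fun k l n hn M hM => ?_
  have hM' := measAfter_ancillaMap_mem hM hK
  have hP := isPOVM_of_mem_closedLOCCMeasurements hM'
  refine le_trans ?_ (le_measDivergence Φ F hn hM')
  simp only [ancillaMap_comp, measAfter_comp]
  refine measRelEntropy_mono fun x => ?_
  exact relEntropy_dualMap_le hL.1.ancillaMap (ancillaMap_map_one hL1)
    ((isPOVM_measAfter hP (isChannel_ancillaMap hΦ)).1 x)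
    ((isPOVM_measAfter hP (isChannel_ancillaMap hF)).1 x)

/-- Monotonicity of the measurement-entangling power. -/
theorem measEntanglingPower_comp_le (N : Set ℕ) {Φ K L : Op (A × B) →ₗ[ℂ] Op (A × B)}
    (hΦ : IsChannel Φ) (hK : K ∈ closedLOCC A B) (hL : L ∈ closedLOCC A B) (hL1 : L 1 = 1) :
    measEntanglingPower N (K ∘ₗ Φ ∘ₗ L) ≤ measEntanglingPower N Φ :=
  -- Each competitor `F` for `Φ` yields the competitor `K ∘ₗ F ∘ₗ L` for the processed map.
  le_iInf₂ fun _ hF => (measEntanglingPower_le N _ (closedLOCC_comp hK (closedLOCC_comp hF hL))).trans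
    (measDivergence_comp_le N hΦ (isChannel_of_mem_closedLOCC hF) hK
      (isChannel_of_mem_closedLOCC hL) hL1)

theorem measAfter_add_smul {S ι : Type} [Fintype S] [DecidableEq S] (M : ι → Op S) (c d : ℂ)
    (Φ Γ : Op S →ₗ[ℂ] Op S) : measAfter M (c • Φ + d • Γ) =
      fun x => c • measAfter M Φ x + d • measAfter M Γ x := by
  funext x
  ext i j
  simp [measAfter, dualMap, Matrix.mul_add]

theorem measDivergence_convex (N : Set ℕ) {Φ Γ F G : Op (A × B) →ₗ[ℂ] Op (A × B)}
    (hΦ : IsChannel Φ) (hΓ : IsChannel Γ) (hF : IsChannel F) (hG : IsChannel G) {p q : ℝ}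
    (hp : 0 < p) (hq : 0 < q) :
    measDivergence N ((p : ℂ) • Φ + (q : ℂ) • Γ) ((p : ℂ) • F + (q : ℂ) • G) ≤
      (p : EReal) * measDivergence N Φ F + (q : EReal) * measDivergence N Γ G := by
  refine measDivergence_le fun k l n hn M hM => ?_
  have hM' := isPOVM_of_mem_closedLOCCMeasurements hM
  have hch : ∀ {Φ : Op (A × B) →ₗ[ℂ] Op (A × B)}, IsChannel Φ →
      IsPOVM (measAfter M (ancillaMap (Fin (k + 1)) (Fin (l + 1)) Φ)) :=
    fun h => isPOVM_measAfter hM' (isChannel_ancillaMap h)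
  simp only [ancillaMap_add, ancillaMap_smul, measAfter_add_smul]
  refine (measRelEntropy_convex (hch hΦ) (hch hF) (hch hΓ) (hch hG) hp hq).trans ?_
  exact add_le_add
    (mul_le_mul_of_nonneg_left (le_measDivergence Φ F hn hM) (EReal.coe_nonneg.2 hp.le))
    (mul_le_mul_of_nonneg_left (le_measDivergence Γ G hn hM) (EReal.coe_nonneg.2 hq.le))

theorem exists_measDivergence_lt {N : Set ℕ} {Φ : Op (A × B) →ₗ[ℂ] Op (A × B)} {c : EReal}
    (h : measEntanglingPower N Φ < c) : ∃ F ∈ closedLOCC A B, measDivergence N Φ F < c := by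
  obtain ⟨F, hF⟩ := iInf_lt_iff.1 h
  obtain ⟨hF', h'⟩ := iInf_lt_iff.1 hF
  exact ⟨F, hF', h'⟩

/-- Convexity of the measurement-entangling power. -/
theorem measEntanglingPower_convex [Nonempty A] [Nonempty B] {N : Set ℕ} (hN : ∃ n ∈ N, 2 ≤ n)
    {Φ Γ : Op (A × B) →ₗ[ℂ] Op (A × B)} (hΦ : IsChannel Φ) (hΓ : IsChannel Γ) {p q : ℝ}
    (hp : 0 < p) (hq : 0 < q) (hpq : p + q = 1) :
    measEntanglingPower N ((p : ℂ) • Φ + (q : ℂ) • Γ) ≤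
      (p : EReal) * measEntanglingPower N Φ + (q : EReal) * measEntanglingPower N Γ := by
  have h1 := measEntanglingPower_nonneg hN hΦ
  have h2 := measEntanglingPower_nonneg hN hΓ
  have nb : ∀ {r : ℝ} {e : EReal}, 0 < r → 0 ≤ e → (r : EReal) * e ≠ ⊥ := fun hr he =>
    (lt_of_lt_of_le EReal.bot_lt_zero (EReal.mul_nonneg (EReal.coe_nonneg.2 hr.le) he)).ne'
  by_cases t1 : measEntanglingPower N Φ = ⊤
  · rw [t1, EReal.coe_mul_top_of_pos hp, EReal.top_add_of_ne_bot (nb hq h2)]; exact le_top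
  by_cases t2 : measEntanglingPower N Γ = ⊤
  · rw [t2, EReal.coe_mul_top_of_pos hq, EReal.add_top_of_ne_bot (nb hp h1)]; exact le_top
  have b1 := (lt_of_lt_of_le EReal.bot_lt_zero h1).ne'
  have b2 := (lt_of_lt_of_le EReal.bot_lt_zero h2).ne'
  obtain ⟨e₁, he₁⟩ : ∃ e : ℝ, measEntanglingPower N Φ = e :=
    ⟨_, (EReal.coe_toReal t1 b1).symm⟩
  obtain ⟨e₂, he₂⟩ : ∃ e : ℝ, measEntanglingPower N Γ = e :=
    ⟨_, (EReal.coe_toReal t2 b2).symm⟩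
  rw [he₁, he₂, ← EReal.coe_mul, ← EReal.coe_mul, ← EReal.coe_add]
  refine EReal.le_of_forall_lt_iff_le.1 fun z hz => ?_
  have hz' := EReal.coe_lt_coe_iff.1 hz
  -- Both competitors may be off by the whole slack: since `p + q = 1`, the mixture is off by at
  -- most `ε`.
  set ε := z - (p * e₁ + q * e₂) with hε
  have hε0 : 0 < ε := by rw [hε]; linarith
  obtain ⟨F, hF, hF'⟩ := exists_measDivergence_lt (N := N) (Φ := Φ) (c := ((e₁ + ε : ℝ) : EReal))
    (by rw [he₁]; exact EReal.coe_lt_coe_iff.2 (by linarith))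
  obtain ⟨G, hG, hG'⟩ := exists_measDivergence_lt (N := N) (Φ := Γ) (c := ((e₂ + ε : ℝ) : EReal))
    (by rw [he₂]; exact EReal.coe_lt_coe_iff.2 (by linarith))
  refine (measEntanglingPower_le N _ (closedLOCC_convex hF hG hp.le hq.le hpq)).trans ?_
  refine (measDivergence_convex N hΦ hΓ (isChannel_of_mem_closedLOCC hF)
    (isChannel_of_mem_closedLOCC hG) hp hq).trans ?_
  refine (add_le_add (mul_le_mul_of_nonneg_left hF'.le (EReal.coe_nonneg.2 hp.le))
    (mul_le_mul_of_nonneg_left hG'.le (EReal.coe_nonneg.2 hq.le))).trans ?_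
  rw [← EReal.coe_mul, ← EReal.coe_mul, ← EReal.coe_add]
  refine EReal.coe_le_coe_iff.2 ?_
  have : q = 1 - p := by linarith
  subst this
  rw [hε]
  linarith

-- With one-dimensional ancillas, the Pinsker-type bound gives convergence of the dual maps on
-- products of effects. Such products span, so the duals converge on every product operator, in
-- particular on matrix units, which determine the entries of `F m X`.
open Filter Topology in
theorem tendsto_of_measDivergence_lt [Nonempty A] [Nonempty B] {N : Set ℕ}
    (hN : ∃ n ∈ N, 2 ≤ n) {Φ : Op (A × B) →ₗ[ℂ] Op (A × B)} (hΦ : IsChannel Φ)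
    {F : ℕ → (Op (A × B) →ₗ[ℂ] Op (A × B))} (hF : ∀ m, IsChannel (F m))
    (h : ∀ m : ℕ, measDivergence N Φ (F m) < ((1 / ((m : ℝ) + 1) : ℝ) : EReal))
    (X : Op (A × B)) (a b : A × B) :
    Tendsto (fun m => F m X a b) atTop (𝓝 (Φ X a b)) := by
  obtain ⟨n, hn, hn2⟩ := hN
  let anc : (Op (A × B) →ₗ[ℂ] Op (A × B)) →
      (Op ((A × Fin (0 + 1)) × (B × Fin (0 + 1))) →ₗ[ℂ]
        Op ((A × Fin (0 + 1)) × (B × Fin (0 + 1)))) :=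
    ancillaMap (Fin (0 + 1)) (Fin (0 + 1))
  let good : Op ((A × Fin (0 + 1)) × (B × Fin (0 + 1))) → Prop := fun Y =>
    ∀ i j, Tendsto (fun m => dualLinearMap (anc (F m)) Y i j) atTop
      (𝓝 (dualLinearMap (anc Φ) Y i j))
  have gadd : ∀ Y Y', good Y → good Y' → good (Y + Y') := fun Y Y' hY hY' i j => by
    simp only [map_add, Matrix.add_apply]
    exact (hY i j).add (hY' i j)
  have gsmul : ∀ (c : ℂ) Y, good Y → good (c • Y) := fun c Y hY i j => by
    simp only [map_smul, Matrix.smul_apply]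
    exact (hY i j).const_smul c
  have geff : ∀ (P : Op (A × Fin (0 + 1))) (Q : Op (B × Fin (0 + 1))), P.PosSemidef →
      (1 - P).PosSemidef → Q.PosSemidef → (1 - Q).PosSemidef → good (Matrix.kronecker P Q) := by
    intro P Q hP hP' hQ hQ' i j
    obtain ⟨M, hM, x, hx⟩ := exists_measurement_of_effects hn2 hP hP' hQ hQ'
    have hM' := isPOVM_of_mem_closedLOCCMeasurements hM
    rw [tendsto_iff_norm_sub_tendsto_zero]
    set c : ℝ := 4 * Fintype.card ((A × Fin (0 + 1)) × (B × Fin (0 + 1))) with hc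
    have hlim : Tendsto (fun m : ℕ => √(c * (1 / ((m : ℝ) + 1)))) atTop (𝓝 0) := by
      have := (Real.continuous_sqrt.tendsto (c * 0)).comp
        (tendsto_one_div_add_atTop_nhds_zero_nat.const_mul c)
      simpa [Function.comp_def] using this
    refine squeeze_zero (fun m => norm_nonneg _) (fun m => ?_) hlim
    have h1 := normSq_sub_le_of_measRelEntropy_le
      (isPOVM_measAfter hM' (isChannel_ancillaMap hΦ))
      (isPOVM_measAfter hM' (isChannel_ancillaMap (hF m)))
      ((le_measDivergence Φ (F m) hn hM).trans (h m).le) x i j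
    rw [Complex.normSq_eq_norm_sq, norm_sub_rev] at h1
    simp only [measAfter, hx] at h1
    exact Real.le_sqrt_of_sq_le h1
  have gkron : ∀ (P : Op (A × Fin (0 + 1))) (Q : Op (B × Fin (0 + 1))),
      good (Matrix.kronecker P Q) := by
    intro P
    refine effect_induction (fun Q Q' hQ hQ' => ?_) (fun c Q hQ => ?_) fun Q hQ hQ' => ?_
    · have := gadd _ _ hQ hQ'
      rwa [Matrix.kronecker, ← Matrix.kronecker_add] at this
    · have := gsmul c _ hQ
      rwa [Matrix.kronecker, ← Matrix.kronecker_smul] at this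
    · revert P
      refine effect_induction (fun P P' hP hP' => ?_) (fun c P hP => ?_) fun P hP hP' => ?_
      · have := gadd _ _ hP hP'
        rwa [Matrix.kronecker, ← Matrix.add_kronecker] at this
      · have := gsmul c _ hP
        rwa [Matrix.kronecker, ← Matrix.smul_kronecker] at this
      · exact geff P Q hP hP' hQ hQ'
  -- `X` is viewed on the system with trivial ancillas; `0 + 1` matches the dimensions `k + 1` and
  -- `l + 1` at `k = l = 0`.
  let X' : Op ((A × Fin (0 + 1)) × (B × Fin (0 + 1))) :=
    X.submatrix (fun p => (p.1.1, p.2.1)) fun p => (p.1.1, p.2.1)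
  have key : ∀ Ψ : Op (A × B) →ₗ[ℂ] Op (A × B), Ψ X a b =
      (dualLinearMap (anc Ψ) (Matrix.single ((b.1, 0), (b.2, 0)) ((a.1, 0), (a.2, 0)) 1) *
        X').trace := by
    intro Ψ
    refine Eq.trans ?_ (trace_dualMap_mul (anc Ψ) _ X').symm
    rw [Matrix.trace_single_mul, one_smul]
    rfl
  simp only [key, Matrix.trace, Matrix.diag_apply, Matrix.mul_apply]
  refine tendsto_finsetSum _ fun i _ => tendsto_finsetSum _ fun j _ => Tendsto.mul_const _ ?_
  have := gkron (Matrix.single (b.1, 0) (a.1, 0) 1) (Matrix.single (b.2, 0) (a.2, 0) 1)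
  rw [Matrix.kronecker, Matrix.single_kronecker_single, one_mul] at this
  exact this i j

/-- Faithfulness of the measurement-entangling power. -/
theorem mem_closedLOCC_of_measEntanglingPower_eq_zero [Nonempty A] [Nonempty B] {N : Set ℕ}
    (hN : ∃ n ∈ N, 2 ≤ n) {Φ : Op (A × B) →ₗ[ℂ] Op (A × B)} (hΦ : IsChannel Φ)
    (h : measEntanglingPower N Φ = 0) : Φ ∈ closedLOCC A B := by
  have h1 : ∀ m : ℕ, ∃ F ∈ closedLOCC A B,
      measDivergence N Φ F < ((1 / ((m : ℝ) + 1) : ℝ) : EReal) := fun m =>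
    exists_measDivergence_lt (by rw [h]; exact EReal.coe_pos.2 (by positivity))
  choose F hF hF' using h1
  have ht := tendsto_of_measDivergence_lt hN hΦ (fun m => isChannel_of_mem_closedLOCC (hF m)) hF'
  refine isClosed_closedLOCC.mem_of_tendsto (f := F) (b := Filter.atTop) ?_
    (Filter.Eventually.of_forall hF)
  have hind : Topology.IsInducing fun Ψ : Op (A × B) →ₗ[ℂ] Op (A × B) =>
      (Ψ : Op (A × B) → Op (A × B)) := ⟨rfl⟩
  rw [hind.tendsto_nhds_iff]
  exact tendsto_pi_nhds.2 fun X => tendsto_pi_nhds.2 fun a => tendsto_pi_nhds.2 fun b => ht X a b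

end Power

end QuantumResource

theorem mainTheorem10 {A B : Type} [Fintype A] [Fintype B] [DecidableEq A] [DecidableEq B]
    [Nonempty A] [Nonempty B] (N : Set ℕ) (hN : ∃ n ∈ N, 2 ≤ n) :
    (∀ Φ : Op (A × B) →ₗ[ℂ] Op (A × B), IsChannel Φ →
      0 ≤ measEntanglingPower N Φ ∧
      (measEntanglingPower N Φ = 0 ↔ Φ ∈ closedLOCC A B)) ∧
    (∀ Φ K L : Op (A × B) →ₗ[ℂ] Op (A × B), IsChannel Φ →
      K ∈ closedLOCC A B → L ∈ closedLOCC A B → L 1 = 1 →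
      measEntanglingPower N (K ∘ₗ Φ ∘ₗ L) ≤ measEntanglingPower N Φ) ∧
    (∀ (Φ Γ : Op (A × B) →ₗ[ℂ] Op (A × B)) (p : ℝ), IsChannel Φ → IsChannel Γ →
      0 ≤ p → p ≤ 1 →
      measEntanglingPower N ((p : ℂ) • Φ + ((1 - p : ℝ) : ℂ) • Γ) ≤
        (p : EReal) * measEntanglingPower N Φ +
          ((1 - p : ℝ) : EReal) * measEntanglingPower N Γ) := by
  refine ⟨fun Φ hΦ => ⟨measEntanglingPower_nonneg hN hΦ,
    mem_closedLOCC_of_measEntanglingPower_eq_zero hN hΦ, fun h => le_antisymm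
      ((measEntanglingPower_le N Φ h).trans (measDivergence_self_le N Φ))
      (measEntanglingPower_nonneg hN hΦ)⟩,
    fun Φ K L hΦ hK hL hL1 => measEntanglingPower_comp_le N hΦ hK hL hL1,
    fun Φ Γ p hΦ hΓ hp hp1 => ?_⟩
  -- The endpoints are separate because the convexity lemma takes strictly positive weights; there
  -- `0 * ⊤ = 0` in `EReal` makes the two sides equal.
  rcases hp.eq_or_lt with rfl | hp
  · simp
  rcases hp1.eq_or_lt with rfl | hp1
  · simp
  exact measEntanglingPower_convex hN hΦ hΓ hp (sub_pos.2 hp1) (by ring)
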